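/- Let $A$ and $G$ be sets of agents and goods with $|A|=|G|=n\ge 1$, and let $u_{ij}\ge 0$ $(i\in A,\ j\in G)$ be utilities with $\max_{j\in G}u_{ij}=1$ and $\sum_{j\in G}u_{ij}\ge 1/\kappa$ for every $i\in A$, where $\kappa>0$. Let $$P=\Bigl\{x\in\mathbb R_{\ge 0}^{A\times G} : \sum_{i\in A}x_{ij}\le 1\ \ \forall j\in G,\quad \sum_{j\in G}x_{ij}\le 1\ \ \forall i\in A\Bigr\}$$ be the bipartite matching polytope, $u_i(x)=\sum_{j\in G}u_{ij}x_{ij}$, and $$\psi(x)=\sum_{i\in A}\eta\Bigl(u_i(x);\tfrac1{2\kappa n}\Bigr),\qquad \eta(z;z_0)=\begin{cases}\log z_0+\frac{z-z_0}{z_0}-\frac{(z-z_0)^2}{2z_0^2}&\text{if } z\le z_0,\\ \log z&\text{if } z>z_0.\end{cases}$$ Consider the conditional gradient (Frank–Wolfe) algorithm that starts from $x^{(0)}=0$ and, for $t=1,\dots,T$, computes the weights $w^{(t)}_{ij}=\partial_{ij}\psi(x^{(t-1)})$, takes $y^{(t)}$ to be (the incidence matrix of) any maximum-weight matching of the complete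 bipartite graph on $A\cup G$ with weights $w^{(t)}$, sets $$x^{(t)}=\Bigl(1-\frac2{t+1}\Bigr)x^{(t-1)}+\frac2{t+1}\,y^{(t)},$$ and finally returns $x^{(T)}$. Then $\psi$ attains its maximum over $P$, and there is an absolute constant $C>0$ such that for every such instance, every maximizer $x^*$ of $\psi$ over $P$, every $\varepsilon>0$ and every integer $T\ge C\,n^3\kappa^2/\varepsilon$, the returned point $x^{(T)}$ lies in $P$ and satisfies $\psi(x^*)-\psi(x^{(T)})\le\varepsilon$; that is, $O(n^3\kappa^2/\varepsilon)$ iterations suffice. Moreover, each iteration can be implemented in $O(n^3)$ time: there is a single program for a real random access machine (unit-cost arithmetic and comparisons on real numbers, unit-cost additions, subtractions and comparisons on natural numbers, unit-cost indexed array access) that, given $n,\kappa,u,t$ and $x^{(t-1)}$, computes an $x^{(t)}$ as above in $O(n^3)$ steps, with an absolute implied constant. -/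

import Mathlib

/-! ## The market, the modified program and the conditional gradient algorithm -/

namespace LiF

/-- An allocation of `n` goods to `n` agents: `x i j` is the amount of good `j` given to agent `i`. -/
abbrev Alloc (n : ℕ) : Type := Fin n → Fin n → ℝ

/-- Utility matrices `u` (agent `i`, good `j`) that are non-negative, rescaled so that
`max_j u i j = 1` for every agent `i`, and satisfy `∑ j, u i j ≥ 1 / κ`. -/
structure IsInstance {n : ℕ} (κ : ℝ) (u : Fin n → Fin n → ℝ) : Prop where
  kappa_pos : 0 < κ
  nonneg : ∀ i j, 0 ≤ u i j
  max_eq_one : ∀ i, IsGreatest (Set.range (u i)) 1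
  sum_ge : ∀ i, 1 / κ ≤ ∑ j, u i j

/-- The utility `u_i(x) = ∑_j u_ij x_ij` of agent `i`. -/
def utility {n : ℕ} (u : Fin n → Fin n → ℝ) (x : Alloc n) (i : Fin n) : ℝ :=
  ∑ j, u i j * x i j

/-- The (fractional) bipartite matching polytope. -/
def matchingPolytope (n : ℕ) : Set (Alloc n) :=
  {x | (∀ j, ∑ i, x i j ≤ 1) ∧ (∀ i, ∑ j, x i j ≤ 1) ∧ ∀ i j, 0 ≤ x i j}

/-- The quadratic extension of the logarithm at `x₀`. -/
noncomputable def eta (x x₀ : ℝ) : ℝ :=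
  if x ≤ x₀ then Real.log x₀ + (x - x₀) * (1 / x₀) - 1 / 2 * (x - x₀) ^ 2 * (1 / x₀ ^ 2)
  else Real.log x

/-- The modified objective `ψ(x) = ∑_i η(u_i(x); 1 / (2 κ n))`. -/
noncomputable def psi {n : ℕ} (κ : ℝ) (u : Fin n → Fin n → ℝ) (x : Alloc n) : ℝ :=
  ∑ i, eta (utility u x i) (1 / (2 * κ * (n : ℝ)))

/-- `x` is an optimal solution of the program: maximize `ψ` over the matching polytope. -/
def IsOptimal {n : ℕ} (κ : ℝ) (u : Fin n → Fin n → ℝ) (x : Alloc n) : Prop :=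
  x ∈ matchingPolytope n ∧ IsMaxOn (psi κ u) (matchingPolytope n) x

/-- The partial derivative `∂_ij ψ(x)`. -/
noncomputable def gradPsi {n : ℕ} (κ : ℝ) (u : Fin n → Fin n → ℝ) (x : Alloc n) :
    Fin n → Fin n → ℝ :=
  fun i j => lineDeriv ℝ (psi κ u) x (Pi.single i (Pi.single j 1))

/-- `y` is the incidence matrix of a matching in the complete bipartite graph on agents and goods. -/
def IsMatching {n : ℕ} (y : Alloc n) : Prop :=
  (∀ i j, y i j = 0 ∨ y i j = 1) ∧ (∀ j, ∑ i, y i j ≤ 1) ∧ ∀ i, ∑ j, y i j ≤ 1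

/-- `y` is the incidence matrix of a matching of maximum total weight with respect to `w`. -/
def IsMaxWeightMatching {n : ℕ} (w : Fin n → Fin n → ℝ) (y : Alloc n) : Prop :=
  IsMatching y ∧ ∀ z : Alloc n, IsMatching z → ∑ i, ∑ j, w i j * z i j ≤ ∑ i, ∑ j, w i j * y i j

/-- `x'` is a possible result of the `t`-th iteration (`t ≥ 1`) of the conditional gradient algorithm
from the iterate `x`; any maximum weight matching may be used. -/
def IsStep {n : ℕ} (κ : ℝ) (u : Fin n → Fin n → ℝ) (t : ℕ) (x x' : Alloc n) : Prop :=
  ∃ y : Alloc n, IsMaxWeightMatching (gradPsi κ u x) y ∧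
    x' = (1 - 2 / ((t : ℝ) + 1)) • x + (2 / ((t : ℝ) + 1)) • y

/-- `x 0, …, x T` are the iterates of a run of `T` iterations of the conditional gradient algorithm;
the run returns `x T`. -/
def IsRun {n : ℕ} (κ : ℝ) (u : Fin n → Fin n → ℝ) (T : ℕ) (x : ℕ → Alloc n) : Prop :=
  x 0 = 0 ∧ ∀ t : ℕ, 1 ≤ t → t ≤ T → IsStep κ u t (x (t - 1)) (x t)

end LiF

/-! ## A real random access machine with unit-cost operations

Programs are finite texts of an imperative language. The memory holds natural numbers (used for
counters and indices) and real numbers, in scalar variables and in arrays whose entries are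
addressed by a row and a column index. Every arithmetic operation, comparison, memory access,
assignment and test has cost one. There is no conversion from reals to natural numbers. -/

namespace RealRAM

/-- The memory: scalar variables and two-dimensional arrays, named by natural numbers. -/
structure State where
  ivar : ℕ → ℕ
  rvar : ℕ → ℝ
  iarr : ℕ → ℕ → ℕ → ℕ
  rarr : ℕ → ℕ → ℕ → ℝ

/-- Expressions of natural-number type (subtraction is truncated). -/
inductive IExpr where
  | const (k : ℕ)
  | var (v : ℕ)
  | get (a : ℕ) (row col : IExpr)
  | add (e₁ e₂ : IExpr)
  | sub (e₁ e₂ : IExpr)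

/-- Expressions of real type (division by zero returns zero). -/
inductive RExpr where
  | ofNat (e : IExpr)
  | var (v : ℕ)
  | get (a : ℕ) (row col : IExpr)
  | add (e₁ e₂ : RExpr)
  | sub (e₁ e₂ : RExpr)
  | mul (e₁ e₂ : RExpr)
  | div (e₁ e₂ : RExpr)

/-- Tests. -/
inductive BExpr where
  | ile (e₁ e₂ : IExpr)
  | rle (e₁ e₂ : RExpr)
  | not (b : BExpr)
  | and (b₁ b₂ : BExpr)

/-- Programs. -/
inductive Cmd where
  | skip
  | iset (v : ℕ) (e : IExpr)
  | rset (v : ℕ) (e : RExpr)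
  | iput (a : ℕ) (row col : IExpr) (e : IExpr)
  | rput (a : ℕ) (row col : IExpr) (e : RExpr)
  | seq (c₁ c₂ : Cmd)
  | ite (b : BExpr) (c₁ c₂ : Cmd)
  | loop (b : BExpr) (c : Cmd)

def IExpr.eval (s : State) : IExpr → ℕ
  | .const k => k
  | .var v => s.ivar v
  | .get a row col => s.iarr a (row.eval s) (col.eval s)
  | .add e₁ e₂ => e₁.eval s + e₂.eval s
  | .sub e₁ e₂ => e₁.eval s - e₂.eval s

def IExpr.cost : IExpr → ℕ
  | .const _ => 1
  | .var _ => 1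
  | .get _ row col => row.cost + col.cost + 1
  | .add e₁ e₂ => e₁.cost + e₂.cost + 1
  | .sub e₁ e₂ => e₁.cost + e₂.cost + 1

noncomputable def RExpr.eval (s : State) : RExpr → ℝ
  | .ofNat e => (e.eval s : ℝ)
  | .var v => s.rvar v
  | .get a row col => s.rarr a (row.eval s) (col.eval s)
  | .add e₁ e₂ => e₁.eval s + e₂.eval s
  | .sub e₁ e₂ => e₁.eval s - e₂.eval s
  | .mul e₁ e₂ => e₁.eval s * e₂.eval s
  | .div e₁ e₂ => e₁.eval s / e₂.eval s

def RExpr.cost : RExpr → ℕ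
  | .ofNat e => e.cost + 1
  | .var _ => 1
  | .get _ row col => row.cost + col.cost + 1
  | .add e₁ e₂ => e₁.cost + e₂.cost + 1
  | .sub e₁ e₂ => e₁.cost + e₂.cost + 1
  | .mul e₁ e₂ => e₁.cost + e₂.cost + 1
  | .div e₁ e₂ => e₁.cost + e₂.cost + 1

def BExpr.holds (s : State) : BExpr → Prop
  | .ile e₁ e₂ => e₁.eval s ≤ e₂.eval s
  | .rle e₁ e₂ => e₁.eval s ≤ e₂.eval s
  | .not b => ¬ b.holds s
  | .and b₁ b₂ => b₁.holds s ∧ b₂.holds s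

def BExpr.cost : BExpr → ℕ
  | .ile e₁ e₂ => e₁.cost + e₂.cost + 1
  | .rle e₁ e₂ => e₁.cost + e₂.cost + 1
  | .not b => b.cost + 1
  | .and b₁ b₂ => b₁.cost + b₂.cost + 1

def State.setI (s : State) (v k : ℕ) : State :=
  { s with ivar := Function.update s.ivar v k }

noncomputable def State.setR (s : State) (v : ℕ) (r : ℝ) : State :=
  { s with rvar := Function.update s.rvar v r }

def State.putI (s : State) (a row col k : ℕ) : State :=
  let newRow := Function.update (s.iarr a row) col k
  { s with iarr := Function.update s.iarr a (Function.update (s.iarr a) row newRow) }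

noncomputable def State.putR (s : State) (a row col : ℕ) (r : ℝ) : State :=
  let newRow := Function.update (s.rarr a row) col r
  { s with rarr := Function.update s.rarr a (Function.update (s.rarr a) row newRow) }

/-- `Exec c s s' k`: started in the memory `s`, the program `c` halts in the memory `s'`, and the
total cost of the operations that it performs is `k`. -/
inductive Exec : Cmd → State → State → ℕ → Prop
  | skip (s : State) : Exec .skip s s 1
  | iset (s : State) (v : ℕ) (e : IExpr) :
      Exec (.iset v e) s (s.setI v (e.eval s)) (e.cost + 1)
  | rset (s : State) (v : ℕ) (e : RExpr) :
      Exec (.rset v e) s (s.setR v (e.eval s)) (e.cost + 1)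
  | iput (s : State) (a : ℕ) (row col : IExpr) (e : IExpr) :
      Exec (.iput a row col e) s (s.putI a (row.eval s) (col.eval s) (e.eval s))
        (row.cost + col.cost + e.cost + 1)
  | rput (s : State) (a : ℕ) (row col : IExpr) (e : RExpr) :
      Exec (.rput a row col e) s (s.putR a (row.eval s) (col.eval s) (e.eval s))
        (row.cost + col.cost + e.cost + 1)
  | seq {c₁ c₂ : Cmd} {s s₁ s₂ : State} {k₁ k₂ : ℕ} :
      Exec c₁ s s₁ k₁ → Exec c₂ s₁ s₂ k₂ → Exec (.seq c₁ c₂) s s₂ (k₁ + k₂)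
  | ite_true {b : BExpr} {c₁ c₂ : Cmd} {s s' : State} {k : ℕ} :
      b.holds s → Exec c₁ s s' k → Exec (.ite b c₁ c₂) s s' (b.cost + 1 + k)
  | ite_false {b : BExpr} {c₁ c₂ : Cmd} {s s' : State} {k : ℕ} :
      ¬ b.holds s → Exec c₂ s s' k → Exec (.ite b c₁ c₂) s s' (b.cost + 1 + k)
  | loop_false {b : BExpr} {c : Cmd} {s : State} :
      ¬ b.holds s → Exec (.loop b c) s s (b.cost + 1)
  | loop_true {b : BExpr} {c : Cmd} {s s₁ s₂ : State} {k₁ k₂ : ℕ} :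
      b.holds s → Exec c s s₁ k₁ → Exec (.loop b c) s₁ s₂ k₂ →
        Exec (.loop b c) s s₂ (b.cost + 1 + k₁ + k₂)

end RealRAM

namespace LiF

/-- The memory `s` holds the size `n`, the iteration counter `t`, the parameter `κ`, the utilities `u`
and the current iterate `x` in fixed places; the rest of the memory is arbitrary. -/
def Stores (s : RealRAM.State) {n : ℕ} (t : ℕ) (κ : ℝ) (u : Fin n → Fin n → ℝ) (x : Alloc n) : Prop :=
  s.ivar 0 = n ∧ s.ivar 1 = t ∧ s.rvar 0 = κ ∧
    (∀ i j : Fin n, s.rarr 0 i j = u i j) ∧ ∀ i j : Fin n, s.rarr 1 i j = x i j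

end LiF

namespace LiF

/-! ### The quadratic extension of the logarithm -/

/-- The derivative of `eta`. -/
noncomputable def etaDeriv (z z₀ : ℝ) : ℝ :=
  if z ≤ z₀ then 2 / z₀ - z / z₀ ^ 2 else 1 / z

theorem hasDerivAt_eta {z₀ : ℝ} (h₀ : 0 < z₀) (z : ℝ) :
    HasDerivAt (fun z => eta z z₀) (etaDeriv z z₀) z := by
  have hq : ∀ z, HasDerivAt
      (fun x => Real.log z₀ + (x - z₀) * (1 / z₀) - 1 / 2 * (x - z₀) ^ 2 * (1 / z₀ ^ 2))
      (2 / z₀ - z / z₀ ^ 2) z := by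
    intro z
    have h1 : HasDerivAt (fun x : ℝ => x - z₀) 1 z := (hasDerivAt_id z).sub_const z₀
    have h2 := ((h1.mul_const (1 / z₀)).const_add (Real.log z₀)).sub
      (((h1.pow 2).const_mul (1 / 2)).mul_const (1 / z₀ ^ 2))
    refine h2.congr_deriv ?_
    field_simp
    simp
    ring
  rcases lt_trichotomy z z₀ with h | h | h
  · have e : etaDeriv z z₀ = 2 / z₀ - z / z₀ ^ 2 := if_pos h.le
    rw [e]
    refine (hq z).congr_of_eventuallyEq ?_
    filter_upwards [Iio_mem_nhds h] with x hx
    exact if_pos (le_of_lt hx)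
  · subst h
    have e : etaDeriv z z = 2 / z - z / z ^ 2 := if_pos le_rfl
    rw [← hasDerivWithinAt_univ, ← Set.Iic_union_Ici (a := z)]
    refine HasDerivWithinAt.union ?_ ?_
    · rw [e]
      exact (hq z).hasDerivWithinAt.congr (fun x hx => if_pos hx) (if_pos le_rfl)
    · have e' : etaDeriv z z = z⁻¹ := by rw [e]; field_simp; ring
      rw [e']
      refine (Real.hasDerivAt_log h₀.ne').hasDerivWithinAt.congr (fun x hx => ?_) ?_
      · rcases eq_or_lt_of_le (show z ≤ x from hx) with hx | hx
        · subst hx; simp [eta]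
        · exact if_neg (not_le.2 hx)
      · simp [eta]
  · have e : etaDeriv z z₀ = z⁻¹ := by rw [etaDeriv, if_neg (not_le.2 h), one_div]
    rw [e]
    refine (Real.hasDerivAt_log (h₀.trans h).ne').congr_of_eventuallyEq ?_
    filter_upwards [Ioi_mem_nhds h] with x hx
    exact if_neg (not_le.2 hx)

theorem etaDeriv_nonneg {z₀ : ℝ} (h₀ : 0 < z₀) (z : ℝ) : 0 ≤ etaDeriv z z₀ := by
  unfold etaDeriv
  split_ifs with h
  · have : 2 / z₀ - z / z₀ ^ 2 = (2 * z₀ - z) / z₀ ^ 2 := by field_simp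
    rw [this]
    apply div_nonneg <;> nlinarith
  · push Not at h
    exact one_div_nonneg.2 (h₀.trans h).le

theorem etaDeriv_antitone {z₀ : ℝ} (h₀ : 0 < z₀) : Antitone (fun z => etaDeriv z z₀) := by
  intro y z hyz
  show etaDeriv z z₀ ≤ etaDeriv y z₀
  unfold etaDeriv
  split_ifs with h1 h2 h2
  · gcongr
  · linarith
  · push Not at h1
    have : 2 / z₀ - y / z₀ ^ 2 = 1 / z₀ + (z₀ - y) / z₀ ^ 2 := by field_simp; ring
    rw [this]
    have h3 : 1 / z ≤ 1 / z₀ := one_div_le_one_div_of_le h₀ h1.le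
    have h4 : 0 ≤ (z₀ - y) / z₀ ^ 2 := div_nonneg (by linarith) (by positivity)
    linarith
  · push Not at h2
    exact one_div_le_one_div_of_le (h₀.trans h2) hyz

theorem etaDeriv_add_monotone {z₀ : ℝ} (h₀ : 0 < z₀) :
    Monotone (fun z => etaDeriv z z₀ + z / z₀ ^ 2) := by
  have key : ∀ y z, z₀ ≤ y → y ≤ z → 1 / y + y / z₀ ^ 2 ≤ 1 / z + z / z₀ ^ 2 := by
    intro y z hy hz
    have hy0 : 0 < y := h₀.trans_le hy
    have hz0 : 0 < z := hy0.trans_le hz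
    have : 1 / z + z / z₀ ^ 2 - (1 / y + y / z₀ ^ 2) = (z - y) * (y * z - z₀ ^ 2) / (y * z * z₀ ^ 2) := by
      field_simp
      ring
    have h2 : 0 ≤ (z - y) * (y * z - z₀ ^ 2) / (y * z * z₀ ^ 2) := by
      apply div_nonneg _ (by positivity)
      apply mul_nonneg (by linarith)
      nlinarith
    linarith
  intro y z hyz
  show etaDeriv y z₀ + y / z₀ ^ 2 ≤ etaDeriv z z₀ + z / z₀ ^ 2
  unfold etaDeriv
  split_ifs with h1 h2 h2
  · linarith
  · push Not at h2
    have := key z₀ z le_rfl h2.le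
    have h3 : 1 / z₀ + z₀ / z₀ ^ 2 = 2 / z₀ := by field_simp; ring
    linarith
  · linarith
  · exact key y z (le_of_lt (not_le.1 h1)) hyz

/-- A differentiable function with monotone derivative lies above its tangents. -/
theorem tangent_le_of_monotone_deriv {f f' : ℝ → ℝ} (hf : ∀ x, HasDerivAt f (f' x) x)
    (hm : Monotone f') (x y : ℝ) : f x + f' x * (y - x) ≤ f y := by
  rcases lt_trichotomy x y with h | h | h
  · obtain ⟨c, hc, e⟩ := exists_hasDerivAt_eq_slope f f' h
      (fun z _ => (hf z).continuousAt.continuousWithinAt) (fun z _ => hf z)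
    have := hm hc.1.le
    rw [e, le_div_iff₀ (by linarith)] at this
    linarith
  · subst h; simp
  · obtain ⟨c, hc, e⟩ := exists_hasDerivAt_eq_slope f f' h
      (fun z _ => (hf z).continuousAt.continuousWithinAt) (fun z _ => hf z)
    have := hm hc.2.le
    rw [e, div_le_iff₀ (by linarith)] at this
    linarith

theorem eta_le_tangent {z₀ : ℝ} (h₀ : 0 < z₀) (x y : ℝ) :
    eta y z₀ ≤ eta x z₀ + etaDeriv x z₀ * (y - x) := by
  have := tangent_le_of_monotone_deriv (f := fun z => -eta z z₀) (f' := fun z => -etaDeriv z z₀)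
    (fun z => (hasDerivAt_eta h₀ z).neg) (fun a b h => neg_le_neg (etaDeriv_antitone h₀ h)) x y
  linarith

theorem tangent_sub_sq_le_eta {z₀ : ℝ} (h₀ : 0 < z₀) (x y : ℝ) :
    eta x z₀ + etaDeriv x z₀ * (y - x) - (y - x) ^ 2 / (2 * z₀ ^ 2) ≤ eta y z₀ := by
  have := tangent_le_of_monotone_deriv (f := fun z => eta z z₀ + z ^ 2 / (2 * z₀ ^ 2))
    (f' := fun z => etaDeriv z z₀ + z / z₀ ^ 2)
    (fun z => ((hasDerivAt_eta h₀ z).add (((hasDerivAt_id z).pow 2).div_const _)).congr_deriv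
      (by simp; field_simp)) (etaDeriv_add_monotone h₀) x y
  have e : (y - x) ^ 2 / (2 * z₀ ^ 2) = y ^ 2 / (2 * z₀ ^ 2) - x ^ 2 / (2 * z₀ ^ 2)
      - x / z₀ ^ 2 * (y - x) := by field_simp; ring
  linarith

/-! ### The objective and its gradient -/

variable {n : ℕ}

theorem utility_add_smul (u : Fin n → Fin n → ℝ) (x d : Alloc n) (c : ℝ) (i : Fin n) :
    utility u (x + c • d) i = utility u x i + c * utility u d i := by
  simp only [utility, Pi.add_apply, Pi.smul_apply, smul_eq_mul, mul_add, Finset.sum_add_distrib,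
    Finset.mul_sum]
  congr 1
  exact Finset.sum_congr rfl fun j _ => by ring

theorem utility_sub (u : Fin n → Fin n → ℝ) (x y : Alloc n) (i : Fin n) :
    utility u (x - y) i = utility u x i - utility u y i := by
  simp [utility, mul_sub, Finset.sum_sub_distrib]

theorem threshold_pos {κ : ℝ} (hκ : 0 < κ) (hn : 0 < n) : 0 < 1 / (2 * κ * (n : ℝ)) := by
  have : (0 : ℝ) < n := Nat.cast_pos.2 hn
  positivity

theorem gradPsi_eq {κ : ℝ} (hκ : 0 < κ) (hn : 0 < n) (u : Fin n → Fin n → ℝ) (x : Alloc n)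
    (i j : Fin n) :
    gradPsi κ u x i j = etaDeriv (utility u x i) (1 / (2 * κ * (n : ℝ))) * u i j := by
  have hz := threshold_pos hκ hn
  set z₀ := 1 / (2 * κ * (n : ℝ))
  have hd : ∀ k, utility u (Pi.single i (Pi.single j 1)) k = if k = i then u i j else 0 := by
    intro k
    by_cases h : k = i
    · subst h; simp [utility, Pi.single_apply]
    · simp [utility, h]
  have : HasDerivAt (fun c : ℝ => psi κ u (x + c • (Pi.single i (Pi.single j 1) : Alloc n)))
      (∑ k, etaDeriv (utility u x k) z₀ * (if k = i then u i j else 0)) 0 := by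
    unfold psi
    refine HasDerivAt.fun_sum fun k _ => ?_
    change HasDerivAt (fun c : ℝ => eta (utility u (x + c • _) k) z₀) _ 0
    simp only [utility_add_smul, hd]
    have h1 : HasDerivAt (fun c : ℝ => utility u x k + c * (if k = i then u i j else 0))
        (if k = i then u i j else 0) 0 := by
      simpa using ((hasDerivAt_id (0 : ℝ)).mul_const (if k = i then u i j else 0)).const_add
        (utility u x k)
    have h2 := hasDerivAt_eta hz (utility u x k + 0 * (if k = i then u i j else 0))
    have h3 := HasDerivAt.comp (0 : ℝ) h2 h1
    simpa [Function.comp_def] using h3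
  unfold gradPsi lineDeriv
  rw [this.deriv]
  simp

theorem sum_gradPsi_mul {κ : ℝ} (hκ : 0 < κ) (hn : 0 < n) (u : Fin n → Fin n → ℝ) (x d : Alloc n) :
    ∑ i, ∑ j, gradPsi κ u x i j * d i j =
      ∑ i, etaDeriv (utility u x i) (1 / (2 * κ * (n : ℝ))) * utility u d i := by
  simp only [gradPsi_eq hκ hn, utility, Finset.mul_sum, mul_assoc]

theorem gradPsi_nonneg {κ : ℝ} {u : Fin n → Fin n → ℝ} (h : IsInstance κ u) (hn : 0 < n)
    (x : Alloc n) (i j : Fin n) : 0 ≤ gradPsi κ u x i j := by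
  rw [gradPsi_eq h.kappa_pos hn]
  exact mul_nonneg (etaDeriv_nonneg (threshold_pos h.kappa_pos hn) _) (h.nonneg i j)

theorem IsInstance.le_one {κ : ℝ} {u : Fin n → Fin n → ℝ} (h : IsInstance κ u) (i j : Fin n) :
    u i j ≤ 1 := (h.max_eq_one i).2 ⟨j, rfl⟩

theorem psi_le_linear {κ : ℝ} (hκ : 0 < κ) (hn : 0 < n) (u : Fin n → Fin n → ℝ) (x y : Alloc n) :
    psi κ u y ≤ psi κ u x + ∑ i, ∑ j, gradPsi κ u x i j * (y - x) i j := by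
  rw [sum_gradPsi_mul hκ hn, psi, psi, ← Finset.sum_add_distrib]
  refine Finset.sum_le_sum fun i _ => ?_
  rw [utility_sub]
  exact eta_le_tangent (threshold_pos hκ hn) _ _

theorem utility_mem_Icc {κ : ℝ} {u : Fin n → Fin n → ℝ} (h : IsInstance κ u) {x : Alloc n}
    (hx : x ∈ matchingPolytope n) (i : Fin n) : utility u x i ∈ Set.Icc (0 : ℝ) 1 := by
  refine ⟨Finset.sum_nonneg fun j _ => mul_nonneg (h.nonneg i j) (hx.2.2 i j), ?_⟩
  refine le_trans (Finset.sum_le_sum fun j _ => ?_) (hx.2.1 i)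
  have := mul_le_mul_of_nonneg_right (h.le_one i j) (hx.2.2 i j)
  linarith

theorem linear_sub_sq_le_psi {κ : ℝ} {u : Fin n → Fin n → ℝ} (h : IsInstance κ u) (hn : 0 < n)
    {x y : Alloc n} (hx : x ∈ matchingPolytope n) (hy : y ∈ matchingPolytope n) (c : ℝ) :
    psi κ u x + c * ∑ i, ∑ j, gradPsi κ u x i j * (y - x) i j - 2 * κ ^ 2 * n ^ 3 * c ^ 2 ≤
      psi κ u (x + c • (y - x)) := by
  have hκ := h.kappa_pos
  have hn' : (0 : ℝ) < n := Nat.cast_pos.2 hn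
  have hz := threshold_pos hκ hn
  have e : 2 * κ ^ 2 * (n : ℝ) ^ 3 * c ^ 2 =
      ∑ _i : Fin n, c ^ 2 / (2 * (1 / (2 * κ * (n : ℝ))) ^ 2) := by
    simp only [Finset.sum_const, Finset.card_univ, Fintype.card_fin, nsmul_eq_mul]
    field_simp
  rw [sum_gradPsi_mul hκ hn, psi, psi, Finset.mul_sum, ← Finset.sum_add_distrib, e,
    ← Finset.sum_sub_distrib]
  refine Finset.sum_le_sum fun i _ => ?_
  rw [utility_add_smul, utility_sub]
  have h1 := tangent_sub_sq_le_eta hz (utility u x i)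
    (utility u x i + c * (utility u y i - utility u x i))
  have hx1 := utility_mem_Icc h hx i
  have hy1 := utility_mem_Icc h hy i
  have h2 : (utility u y i - utility u x i) ^ 2 ≤ 1 := by
    rw [sq_le_one_iff_abs_le_one, abs_le]
    constructor <;> linarith [hx1.1, hx1.2, hy1.1, hy1.2]
  have h3 : (c * (utility u y i - utility u x i)) ^ 2 / (2 * (1 / (2 * κ * (n : ℝ))) ^ 2) ≤
      c ^ 2 / (2 * (1 / (2 * κ * (n : ℝ))) ^ 2) := by
    apply div_le_div_of_nonneg_right _ (by positivity)
    rw [mul_pow]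
    exact mul_le_of_le_one_right (sq_nonneg c) h2
  rw [add_sub_cancel_left] at h1
  linarith

/-! ### The matching polytope -/

theorem isCompact_matchingPolytope (n : ℕ) : IsCompact (matchingPolytope n) := by
  refine IsCompact.of_isClosed_subset (isCompact_Icc (a := (0 : Alloc n)) (b := 1)) ?_ ?_
  · have e : matchingPolytope n = (⋂ j, {x : Alloc n | ∑ i, x i j ≤ 1}) ∩
        ((⋂ i, {x : Alloc n | ∑ j, x i j ≤ 1}) ∩ ⋂ i, ⋂ j, {x : Alloc n | 0 ≤ x i j}) := by
      ext x; simp [matchingPolytope]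
    rw [e]
    refine (isClosed_iInter fun j => ?_).inter ((isClosed_iInter fun i => ?_).inter
      (isClosed_iInter fun i => isClosed_iInter fun j => ?_))
    · exact isClosed_le (by fun_prop) continuous_const
    · exact isClosed_le (by fun_prop) continuous_const
    · exact isClosed_le continuous_const (by fun_prop)
  · rintro x ⟨-, h2, h3⟩
    refine ⟨fun i j => h3 i j, fun i j => ?_⟩
    exact (Finset.single_le_sum (f := fun j => x i j) (fun j _ => h3 i j)
      (Finset.mem_univ j)).trans (h2 i)

theorem convex_matchingPolytope (n : ℕ) : Convex ℝ (matchingPolytope n) := by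
  intro x hx y hy a b ha hb hab
  refine ⟨fun j => ?_, fun i => ?_, fun i j => ?_⟩
  · simp only [Pi.add_apply, Pi.smul_apply, smul_eq_mul, Finset.sum_add_distrib, ← Finset.mul_sum]
    nlinarith [hx.1 j, hy.1 j]
  · simp only [Pi.add_apply, Pi.smul_apply, smul_eq_mul, Finset.sum_add_distrib, ← Finset.mul_sum]
    nlinarith [hx.2.1 i, hy.2.1 i]
  · simp only [Pi.add_apply, Pi.smul_apply, smul_eq_mul]
    have := hx.2.2 i j
    have := hy.2.2 i j
    positivity

theorem zero_mem_matchingPolytope (n : ℕ) : (0 : Alloc n) ∈ matchingPolytope n := by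
  simp [matchingPolytope]

theorem IsMatching.mem_matchingPolytope {y : Alloc n} (hy : IsMatching y) :
    y ∈ matchingPolytope n := by
  refine ⟨hy.2.1, hy.2.2, fun i j => ?_⟩
  rcases hy.1 i j with h | h <;> simp [h]

theorem continuous_psi {κ : ℝ} (hκ : 0 < κ) (hn : 0 < n) (u : Fin n → Fin n → ℝ) :
    Continuous (psi κ u) := by
  have h1 : Continuous fun z => eta z (1 / (2 * κ * (n : ℝ))) :=
    continuous_iff_continuousAt.2 fun z => (hasDerivAt_eta (threshold_pos hκ hn) z).continuousAt
  unfold psi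
  refine continuous_finsetSum _ fun i _ => h1.comp ?_
  unfold utility
  fun_prop

theorem exists_isOptimal {κ : ℝ} (hκ : 0 < κ) (hn : 0 < n) (u : Fin n → Fin n → ℝ) :
    ∃ x, IsOptimal κ u x :=
  (isCompact_matchingPolytope n).exists_isMaxOn ⟨0, zero_mem_matchingPolytope n⟩
    (continuous_psi hκ hn u).continuousOn

/-- A doubly substochastic matrix is dominated by a doubly stochastic one. -/
theorem exists_doublyStochastic_ge {x : Alloc n} (hx : x ∈ matchingPolytope n) :
    ∃ X : Matrix (Fin n) (Fin n) ℝ, X ∈ doublyStochastic ℝ (Fin n) ∧ ∀ i j, x i j ≤ X i j := by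
  obtain ⟨hc, hr, h0⟩ := hx
  set r : Fin n → ℝ := fun i => 1 - ∑ j, x i j with hrdef
  set c : Fin n → ℝ := fun j => 1 - ∑ i, x i j with hcdef
  have hr0 : ∀ i, 0 ≤ r i := fun i => sub_nonneg.2 (hr i)
  have hc0 : ∀ j, 0 ≤ c j := fun j => sub_nonneg.2 (hc j)
  set R := ∑ i, r i with hR
  have hRC : R = ∑ j, c j := by
    simp only [hR, hrdef, hcdef, Finset.sum_sub_distrib]
    rw [Finset.sum_comm]
  have hR0 : 0 ≤ R := Finset.sum_nonneg fun i _ => hr0 i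
  have hadd : ∀ i j, 0 ≤ r i * c j / R := fun i j => div_nonneg (mul_nonneg (hr0 i) (hc0 j)) hR0
  have hcancel : ∀ f : Fin n → ℝ, (∀ i, 0 ≤ f i) → R = ∑ i, f i → ∀ i, f i * R / R = f i := by
    intro f hf hS i
    rcases eq_or_ne R 0 with h | h
    · have := (Finset.sum_eq_zero_iff_of_nonneg (fun i _ => hf i)).1 (hS.symm.trans h) i
        (Finset.mem_univ i)
      simp [this]
    · field_simp
  refine ⟨Matrix.of fun i j => x i j + r i * c j / R, ?_, fun i j => le_add_of_nonneg_right (hadd i j)⟩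
  rw [mem_doublyStochastic_iff_sum]
  simp only [Matrix.of_apply]
  refine ⟨fun i j => add_nonneg (h0 i j) (hadd i j), fun i => ?_, fun j => ?_⟩
  · rw [Finset.sum_add_distrib, ← Finset.sum_div, ← Finset.mul_sum, ← hRC, hcancel r hr0 hR i]
    simp [hrdef]
  · rw [Finset.sum_add_distrib, ← Finset.sum_div, ← Finset.sum_mul, ← hR, mul_comm,
      hcancel c hc0 hRC j]
    simp [hcdef]

/-- A bound for the weights of the perfect matchings holds on the whole matching polytope. -/
theorem sum_mul_le_of_perm {w : Fin n → Fin n → ℝ} (hw : ∀ i j, 0 ≤ w i j) {M : ℝ}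
    (hM : ∀ σ : Equiv.Perm (Fin n), ∑ i, w i (σ i) ≤ M) {x : Alloc n}
    (hx : x ∈ matchingPolytope n) : ∑ i, ∑ j, w i j * x i j ≤ M := by
  obtain ⟨X, hX, hle⟩ := exists_doublyStochastic_ge hx
  have h1 : ∑ i, ∑ j, w i j * x i j ≤ ∑ i, ∑ j, w i j * X i j :=
    Finset.sum_le_sum fun i _ => Finset.sum_le_sum fun j _ =>
      mul_le_mul_of_nonneg_left (hle i j) (hw i j)
  refine h1.trans ?_
  obtain ⟨c, hc0, hc1, rfl⟩ := exists_eq_sum_perm_of_mem_doublyStochastic hX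
  have h2 : ∑ i, ∑ j, w i j * (∑ σ, c σ • σ.permMatrix ℝ : Matrix (Fin n) (Fin n) ℝ) i j =
      ∑ σ, c σ * ∑ i, w i (σ i) := by
    simp only [Matrix.sum_apply, Matrix.smul_apply, smul_eq_mul, Finset.mul_sum]
    rw [Finset.sum_congr rfl fun i _ => Finset.sum_comm, Finset.sum_comm]
    refine Finset.sum_congr rfl fun σ _ => Finset.sum_congr rfl fun i _ => ?_
    simp [Equiv.Perm.permMatrix, PEquiv.toMatrix_apply, mul_comm]
  rw [h2]
  calc ∑ σ, c σ * ∑ i, w i (σ i) ≤ ∑ σ, c σ * M :=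
        Finset.sum_le_sum fun σ _ => mul_le_mul_of_nonneg_left (hM σ) (hc0 σ)
    _ = M := by rw [← Finset.sum_mul, hc1, one_mul]

/-- The incidence matrix of a perfect matching. -/
def permAlloc (σ : Equiv.Perm (Fin n)) : Alloc n := fun i j => if σ i = j then 1 else 0

theorem isMatching_permAlloc (σ : Equiv.Perm (Fin n)) : IsMatching (permAlloc σ) := by
  refine ⟨fun i j => ?_, fun j => ?_, fun i => ?_⟩
  · by_cases h : σ i = j <;> simp [permAlloc, h]
  · simp [permAlloc, ← Equiv.eq_symm_apply]
  · simp [permAlloc]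

theorem sum_mul_permAlloc (w : Fin n → Fin n → ℝ) (σ : Equiv.Perm (Fin n)) :
    ∑ i, ∑ j, w i j * permAlloc σ i j = ∑ i, w i (σ i) := by
  simp [permAlloc]

theorem IsMaxWeightMatching.sum_mul_le {w : Fin n → Fin n → ℝ} (hw : ∀ i j, 0 ≤ w i j)
    {y : Alloc n} (hy : IsMaxWeightMatching w y) {x : Alloc n} (hx : x ∈ matchingPolytope n) :
    ∑ i, ∑ j, w i j * x i j ≤ ∑ i, ∑ j, w i j * y i j :=
  sum_mul_le_of_perm hw
    (fun σ => sum_mul_permAlloc w σ ▸ hy.2 _ (isMatching_permAlloc σ)) hx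

/-- A perfect matching that is tight for a feasible dual solution has maximum weight. -/
theorem isMaxWeightMatching_of_dual {w : Fin n → Fin n → ℝ} (hw : ∀ i j, 0 ≤ w i j)
    (a b : Fin n → ℝ) (hab : ∀ i j, w i j ≤ a i + b j) (σ : Equiv.Perm (Fin n))
    (hσ : ∀ i, w i (σ i) = a i + b (σ i)) : IsMaxWeightMatching w (permAlloc σ) := by
  have hsum : ∀ τ : Equiv.Perm (Fin n), ∑ i, (a i + b (τ i)) = ∑ i, a i + ∑ j, b j := by
    intro τ
    rw [Finset.sum_add_distrib, Equiv.sum_comp τ b]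
  refine ⟨isMatching_permAlloc σ, fun z hz => ?_⟩
  rw [sum_mul_permAlloc]
  refine sum_mul_le_of_perm hw (fun τ => ?_) hz.mem_matchingPolytope
  rw [Finset.sum_congr rfl fun i _ => hσ i, hsum σ, ← hsum τ]
  exact Finset.sum_le_sum fun i _ => hab i _

/-! ### Convergence of the conditional gradient algorithm -/

theorem IsStep.gap_le {κ : ℝ} {u : Fin n → Fin n → ℝ} (h : IsInstance κ u) (hn : 0 < n)
    {t : ℕ} (ht : 1 ≤ t) {x x' xs : Alloc n} (hx : x ∈ matchingPolytope n)
    (hs : IsStep κ u t x x') (hxs : xs ∈ matchingPolytope n) :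
    x' ∈ matchingPolytope n ∧
      psi κ u xs - psi κ u x' ≤ (1 - 2 / ((t : ℝ) + 1)) * (psi κ u xs - psi κ u x) +
        2 * κ ^ 2 * n ^ 3 * (2 / ((t : ℝ) + 1)) ^ 2 := by
  obtain ⟨y, hy, rfl⟩ := hs
  have ht' : (1 : ℝ) ≤ t := by exact_mod_cast ht
  set c := 2 / ((t : ℝ) + 1)
  have hc0 : 0 ≤ c := by positivity
  have hc1 : c ≤ 1 := by
    rw [div_le_one (by linarith)]; linarith
  have hyP := hy.1.mem_matchingPolytope
  refine ⟨convex_matchingPolytope n hx hyP (by linarith) hc0 (by ring), ?_⟩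
  have e : (1 - c) • x + c • y = x + c • (y - x) := by module
  rw [e]
  have h1 := linear_sub_sq_le_psi h hn hx hyP c
  have h2 := psi_le_linear h.kappa_pos hn u x xs
  have h3 := hy.sum_mul_le (gradPsi_nonneg h hn x) hxs
  have h4 : ∑ i, ∑ j, gradPsi κ u x i j * (xs - x) i j ≤
      ∑ i, ∑ j, gradPsi κ u x i j * (y - x) i j := by
    simp only [Pi.sub_apply, mul_sub, Finset.sum_sub_distrib]
    linarith
  nlinarith

theorem IsRun.mem_and_gap_le {κ : ℝ} {u : Fin n → Fin n → ℝ} (h : IsInstance κ u) (hn : 0 < n)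
    {T : ℕ} {x : ℕ → Alloc n} (hrun : IsRun κ u T x) {xs : Alloc n}
    (hxs : xs ∈ matchingPolytope n) :
    ∀ t ≤ T, x t ∈ matchingPolytope n ∧
      (1 ≤ t → psi κ u xs - psi κ u (x t) ≤ 8 * κ ^ 2 * n ^ 3 / ((t : ℝ) + 1)) := by
  intro t
  induction t with
  | zero => intro _; rw [hrun.1]; exact ⟨zero_mem_matchingPolytope n, by simp⟩
  | succ t ih =>
    intro hT
    obtain ⟨hx, hgap⟩ := ih (by omega)
    have hs := hrun.2 (t + 1) (by omega) hT
    rw [Nat.add_sub_cancel] at hs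
    obtain ⟨hx', h1⟩ := hs.gap_le h hn (by omega) hx hxs
    refine ⟨hx', fun _ => h1.trans ?_⟩
    have hD : 0 ≤ κ ^ 2 * (n : ℝ) ^ 3 := by positivity
    set D := κ ^ 2 * (n : ℝ) ^ 3 with hDdef
    have e1 : 8 * κ ^ 2 * (n : ℝ) ^ 3 = 8 * D := by rw [hDdef]; ring
    have e2 : 2 * κ ^ 2 * (n : ℝ) ^ 3 = 2 * D := by rw [hDdef]; ring
    rw [e1] at hgap ⊢
    rw [e2]
    push_cast
    rcases Nat.eq_zero_or_pos t with h0 | h0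
    · subst h0
      norm_num
      linarith
    · have hg := hgap h0
      have ht0 : (0 : ℝ) < t := Nat.cast_pos.2 h0
      have hc : 0 ≤ 1 - 2 / ((t : ℝ) + 1 + 1) := by
        rw [sub_nonneg, div_le_one (by linarith)]
        have : (1 : ℝ) ≤ t := by exact_mod_cast h0
        linarith
      have h2 := mul_le_mul_of_nonneg_left hg hc
      have h3 : (1 - 2 / ((t : ℝ) + 1 + 1)) * (8 * D / ((t : ℝ) + 1)) +
          2 * D * (2 / ((t : ℝ) + 1 + 1)) ^ 2 =
          8 * D / ((t : ℝ) + 1 + 1) - 8 * D / (((t : ℝ) + 1) * (t + 1 + 1) ^ 2) := by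
        field_simp
        ring
      have h4 : 0 ≤ 8 * D / (((t : ℝ) + 1) * (t + 1 + 1) ^ 2) := by positivity
      linarith

theorem IsRun.gap_le_eps {κ : ℝ} {u : Fin n → Fin n → ℝ} (h : IsInstance κ u) (hn : 0 < n)
    {T : ℕ} {x : ℕ → Alloc n} (hrun : IsRun κ u T x) {xs : Alloc n}
    (hxs : xs ∈ matchingPolytope n) {ε : ℝ} (hε : 0 < ε)
    (hT : 8 * ((n : ℝ) ^ 3 * κ ^ 2 / ε) ≤ (T : ℝ)) :
    x T ∈ matchingPolytope n ∧ psi κ u xs - psi κ u (x T) ≤ ε := by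
  have hn' : (0 : ℝ) < n := Nat.cast_pos.2 hn
  have hκ := h.kappa_pos
  have hpos : 0 < 8 * ((n : ℝ) ^ 3 * κ ^ 2 / ε) := by positivity
  have hT0 : (0 : ℝ) < T := hpos.trans_le hT
  obtain ⟨h1, h2⟩ := hrun.mem_and_gap_le h hn hxs T le_rfl
  refine ⟨h1, (h2 (by exact_mod_cast hT0)).trans ?_⟩
  rw [div_le_iff₀ (by linarith)]
  have e : 8 * ((n : ℝ) ^ 3 * κ ^ 2 / ε) = 8 * κ ^ 2 * n ^ 3 / ε := by ring
  rw [e, div_le_iff₀ hε] at hT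
  linarith

end LiF

namespace RealRAM

/-! ### Reasoning about programs with a cost budget -/

/-- Started in `s`, the program `c` halts with cost at most `K` in a memory that satisfies `Q`. -/
def Run (c : Cmd) (s : State) (K : ℕ) (Q : State → Prop) : Prop :=
  ∃ s' k, Exec c s s' k ∧ k ≤ K ∧ Q s'

/-- `c` contains no assignment to the index variable `v`. -/
def Cmd.keepsIvar (v : ℕ) : Cmd → Bool
  | .iset w _ => w != v
  | .seq c₁ c₂ => c₁.keepsIvar v && c₂.keepsIvar v
  | .ite _ c₁ c₂ => c₁.keepsIvar v && c₂.keepsIvar v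
  | .loop _ c => c.keepsIvar v
  | _ => true

/-- `c` contains no assignment to the real variable `v`. -/
def Cmd.keepsRvar (v : ℕ) : Cmd → Bool
  | .rset w _ => w != v
  | .seq c₁ c₂ => c₁.keepsRvar v && c₂.keepsRvar v
  | .ite _ c₁ c₂ => c₁.keepsRvar v && c₂.keepsRvar v
  | .loop _ c => c.keepsRvar v
  | _ => true

/-- `c` contains no assignment to an entry of the index array `v`. -/
def Cmd.keepsIarr (v : ℕ) : Cmd → Bool
  | .iput w _ _ _ => w != v
  | .seq c₁ c₂ => c₁.keepsIarr v && c₂.keepsIarr v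
  | .ite _ c₁ c₂ => c₁.keepsIarr v && c₂.keepsIarr v
  | .loop _ c => c.keepsIarr v
  | _ => true

/-- `c` contains no assignment to an entry of the real array `v`. -/
def Cmd.keepsRarr (v : ℕ) : Cmd → Bool
  | .rput w _ _ _ => w != v
  | .seq c₁ c₂ => c₁.keepsRarr v && c₂.keepsRarr v
  | .ite _ c₁ c₂ => c₁.keepsRarr v && c₂.keepsRarr v
  | .loop _ c => c.keepsRarr v
  | _ => true

/-- `s'` agrees with `s` on all that `c` does not assign. -/
structure Frame (c : Cmd) (s s' : State) : Prop where
  ivar : ∀ v, c.keepsIvar v = true → s'.ivar v = s.ivar v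
  rvar : ∀ v, c.keepsRvar v = true → s'.rvar v = s.rvar v
  iarr : ∀ v, c.keepsIarr v = true → s'.iarr v = s.iarr v
  rarr : ∀ v, c.keepsRarr v = true → s'.rarr v = s.rarr v

theorem Frame.refl (c : Cmd) (s : State) : Frame c s s :=
  ⟨fun _ _ => rfl, fun _ _ => rfl, fun _ _ => rfl, fun _ _ => rfl⟩

theorem Frame.trans {c : Cmd} {s s' s'' : State} (h : Frame c s s') (h' : Frame c s' s'') :
    Frame c s s'' :=
  ⟨fun v e => (h'.ivar v e).trans (h.ivar v e), fun v e => (h'.rvar v e).trans (h.rvar v e),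
    fun v e => (h'.iarr v e).trans (h.iarr v e), fun v e => (h'.rarr v e).trans (h.rarr v e)⟩

theorem Frame.mono {c d : Cmd} {s s' : State} (h : Frame c s s')
    (hi : ∀ v, d.keepsIvar v = true → c.keepsIvar v = true)
    (hr : ∀ v, d.keepsRvar v = true → c.keepsRvar v = true)
    (hia : ∀ v, d.keepsIarr v = true → c.keepsIarr v = true)
    (hra : ∀ v, d.keepsRarr v = true → c.keepsRarr v = true) : Frame d s s' :=
  ⟨fun v e => h.ivar v (hi v e), fun v e => h.rvar v (hr v e),
    fun v e => h.iarr v (hia v e), fun v e => h.rarr v (hra v e)⟩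

theorem Frame.seq_left {c₁ c₂ : Cmd} {s s' : State} (h : Frame c₁ s s') :
    Frame (.seq c₁ c₂) s s' := by
  apply h.mono <;> simp +contextual [Cmd.keepsIvar, Cmd.keepsRvar, Cmd.keepsIarr, Cmd.keepsRarr]

theorem Frame.seq_right {c₁ c₂ : Cmd} {s s' : State} (h : Frame c₂ s s') :
    Frame (.seq c₁ c₂) s s' := by
  apply h.mono <;> simp +contextual [Cmd.keepsIvar, Cmd.keepsRvar, Cmd.keepsIarr, Cmd.keepsRarr]

theorem Frame.loop {b : BExpr} {c : Cmd} {s s' : State} (h : Frame c s s') :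
    Frame (.loop b c) s s' := by
  apply h.mono <;> simp [Cmd.keepsIvar, Cmd.keepsRvar, Cmd.keepsIarr, Cmd.keepsRarr]

theorem Exec.frame {c : Cmd} {s s' : State} {k : ℕ} (h : Exec c s s' k) : Frame c s s' := by
  induction h with
  | skip s => exact Frame.refl _ _
  | iset s v e =>
    refine ⟨fun w hw => ?_, fun _ _ => rfl, fun _ _ => rfl, fun _ _ => rfl⟩
    have : w ≠ v := by rintro rfl; simp [Cmd.keepsIvar] at hw
    simp [State.setI, this]
  | rset s v e =>
    refine ⟨fun _ _ => rfl, fun w hw => ?_, fun _ _ => rfl, fun _ _ => rfl⟩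
    have : w ≠ v := by rintro rfl; simp [Cmd.keepsRvar] at hw
    simp [State.setR, this]
  | iput s a r c e =>
    refine ⟨fun _ _ => rfl, fun _ _ => rfl, fun w hw => ?_, fun _ _ => rfl⟩
    have : w ≠ a := by rintro rfl; simp [Cmd.keepsIarr] at hw
    simp [State.putI, this]
  | rput s a r c e =>
    refine ⟨fun _ _ => rfl, fun _ _ => rfl, fun _ _ => rfl, fun w hw => ?_⟩
    have : w ≠ a := by rintro rfl; simp [Cmd.keepsRarr] at hw
    simp [State.putR, this]
  | seq _ _ h₁ h₂ => exact h₁.seq_left.trans h₂.seq_right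
  | ite_true _ _ h =>
    apply h.mono <;> simp +contextual [Cmd.keepsIvar, Cmd.keepsRvar, Cmd.keepsIarr, Cmd.keepsRarr]
  | ite_false _ _ h =>
    apply h.mono <;> simp +contextual [Cmd.keepsIvar, Cmd.keepsRvar, Cmd.keepsIarr, Cmd.keepsRarr]
  | loop_false _ => exact Frame.refl _ _
  | loop_true _ _ _ h₁ h₂ => exact h₁.loop.trans h₂

theorem Run.mono {c : Cmd} {s : State} {K K' : ℕ} {Q Q' : State → Prop} (h : Run c s K Q)
    (hK : K ≤ K') (hQ : ∀ s', Frame c s s' → Q s' → Q' s') : Run c s K' Q' := by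
  obtain ⟨s', k, he, hk, hq⟩ := h
  exact ⟨s', k, he, hk.trans hK, hQ _ he.frame hq⟩

theorem Run.seq {c₁ c₂ : Cmd} {s : State} {K₁ K₂ : ℕ} {P Q : State → Prop} (h₁ : Run c₁ s K₁ P)
    (h₂ : ∀ s', Frame c₁ s s' → P s' → Run c₂ s' K₂ Q) : Run (.seq c₁ c₂) s (K₁ + K₂) Q := by
  obtain ⟨s₁, k₁, he₁, hk₁, hp⟩ := h₁
  obtain ⟨s₂, k₂, he₂, hk₂, hq⟩ := h₂ s₁ he₁.frame hp
  exact ⟨s₂, _, he₁.seq he₂, by omega, hq⟩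

theorem Run.loop {b : BExpr} {c : Cmd} {s₀ : State} (Inv : State → Prop) (V : State → ℕ) {K : ℕ}
    (h₀ : Inv s₀)
    (hstep : ∀ s, Frame (.loop b c) s₀ s → Inv s → b.holds s →
      Run c s K fun s' => Inv s' ∧ V s' < V s) :
    Run (.loop b c) s₀ ((V s₀ + 1) * (K + b.cost + 1)) fun s => Inv s ∧ ¬ b.holds s := by
  have key : ∀ m s, V s ≤ m → Frame (.loop b c) s₀ s → Inv s →
      Run (.loop b c) s ((m + 1) * (K + b.cost + 1)) fun s => Inv s ∧ ¬ b.holds s := by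
    intro m
    induction m with
    | zero =>
      intro s hV hF hI
      by_cases hb : b.holds s
      · obtain ⟨s₁, k₁, he₁, hk₁, hI₁, hV₁⟩ := hstep s hF hI hb
        omega
      · exact ⟨s, _, Exec.loop_false hb, by omega, hI, hb⟩
    | succ m ih =>
      intro s hV hF hI
      by_cases hb : b.holds s
      · obtain ⟨s₁, k₁, he₁, hk₁, hI₁, hV₁⟩ := hstep s hF hI hb
        obtain ⟨s₂, k₂, he₂, hk₂, hI₂⟩ := ih s₁ (by omega) (hF.trans he₁.frame.loop) hI₁
        refine ⟨s₂, _, Exec.loop_true hb he₁ he₂, ?_, hI₂⟩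
        have : (m + 1 + 1) * (K + b.cost + 1) = (m + 1) * (K + b.cost + 1) + (K + b.cost + 1) := by
          ring
        omega
      · refine ⟨s, _, Exec.loop_false hb, ?_, hI, hb⟩
        exact le_trans (by omega) (Nat.le_mul_of_pos_left _ (by omega))
  exact key _ s₀ le_rfl (Frame.refl _ _) h₀

/-- Run `c` for the values `0, …, N - 1` of the index variable `v`. -/
def forLoop (v : ℕ) (N : IExpr) (c : Cmd) : Cmd :=
  .seq (.iset v (.const 0))
    (.loop (.not (.ile N (.var v))) (.seq c (.iset v (.add (.var v) (.const 1)))))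

theorem Run.forLoop {v : ℕ} {N : IExpr} {c : Cmd} {s₀ : State} {m K : ℕ}
    (Inv : ℕ → State → Prop) (hc : c.keepsIvar v = true)
    (hN : ∀ s, Frame (forLoop v N c) s₀ s → N.eval s = m)
    (h₀ : Inv 0 (s₀.setI v 0))
    (hstep : ∀ i < m, ∀ s, Frame (RealRAM.forLoop v N c) s₀ s → s.ivar v = i → Inv i s →
      Run c s K fun s' => Inv (i + 1) (s'.setI v (i + 1))) :
    Run (RealRAM.forLoop v N c) s₀ ((m + 1) * (K + N.cost + 10)) (Inv m) := by
  have hinit : Exec (.iset v (.const 0)) s₀ (s₀.setI v 0) 2 := Exec.iset s₀ v (.const 0)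
  have hF₀ : Frame (RealRAM.forLoop v N c) s₀ (s₀.setI v 0) := hinit.frame.seq_left
  have hloop := Run.loop (b := .not (.ile N (.var v)))
    (c := .seq c (.iset v (.add (.var v) (.const 1)))) (s₀ := s₀.setI v 0) (K := K + 4)
    (fun s => s.ivar v ≤ m ∧ Inv (s.ivar v) s) (fun s => m - s.ivar v)
    (by simpa [State.setI] using h₀) (fun s hF hI hb => by
      have hF' : Frame (RealRAM.forLoop v N c) s₀ s := hF₀.trans hF.seq_right
      have hlt : s.ivar v < m := by
        have := hN s hF'
        simp only [BExpr.holds, IExpr.eval, this] at hb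
        omega
      refine Run.seq (hstep _ hlt s hF' rfl hI.2) fun s' hs' hI' => ?_
      have hv : s'.ivar v = s.ivar v := hs'.ivar v hc
      refine ⟨_, _, Exec.iset s' v _, le_rfl, ?_⟩
      have e : (s'.setI v ((IExpr.add (.var v) (.const 1)).eval s')).ivar v = s.ivar v + 1 := by
        simp [State.setI, IExpr.eval, hv]
      have e' : (IExpr.add (.var v) (.const 1)).eval s' = s.ivar v + 1 := by
        simp [IExpr.eval, hv]
      beta_reduce
      rw [e]
      exact ⟨⟨by omega, by rw [e']; exact hI'⟩, by omega⟩)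
  have e0 : (s₀.setI v 0).ivar v = 0 := by simp [State.setI]
  have hs := Run.seq (P := fun s => s = s₀.setI v 0) ⟨_, 2, hinit, le_rfl, rfl⟩
    (fun s' _ e => by subst e; exact hloop)
  refine hs.mono ?_ ?_
  · rw [e0]
    simp only [BExpr.cost, IExpr.cost]
    have : (m + 1) * (K + N.cost + 10) = (m + 1) * (K + 4 + (N.cost + 1 + 1 + 1) + 1) + 2 * (m + 1) := by
      ring
    have h2 : (m - 0 + 1) * (K + 4 + (N.cost + 1 + 1 + 1) + 1) =
      (m + 1) * (K + 4 + (N.cost + 1 + 1 + 1) + 1) := by simp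
    rw [this, h2]
    omega
  · intro s hF ⟨⟨hle, hI⟩, hb⟩
    have := hN s hF
    simp only [BExpr.holds, IExpr.eval, this, not_not] at hb
    have hm : s.ivar v = m := by omega
    rwa [hm] at hI

/-! ### Programs without loops -/

/-- `c` contains no loop. -/
def Cmd.loopFree : Cmd → Bool
  | .seq c₁ c₂ => c₁.loopFree && c₂.loopFree
  | .ite _ c₁ c₂ => c₁.loopFree && c₂.loopFree
  | .loop _ _ => false
  | _ => true

open Classical in
/-- The memory after a run of a program without loops. -/
noncomputable def Cmd.result : Cmd → State → State
  | .skip, s => s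
  | .iset v e, s => s.setI v (e.eval s)
  | .rset v e, s => s.setR v (e.eval s)
  | .iput a row col e, s => s.putI a (row.eval s) (col.eval s) (e.eval s)
  | .rput a row col e, s => s.putR a (row.eval s) (col.eval s) (e.eval s)
  | .seq c₁ c₂, s => c₂.result (c₁.result s)
  | .ite b c₁ c₂, s => if b.holds s then c₁.result s else c₂.result s
  | .loop _ _, s => s

/-- An upper bound for the cost of a program without loops. -/
def Cmd.maxCost : Cmd → ℕ
  | .skip => 1
  | .iset _ e => e.cost + 1
  | .rset _ e => e.cost + 1
  | .iput _ row col e => row.cost + col.cost + e.cost + 1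
  | .rput _ row col e => row.cost + col.cost + e.cost + 1
  | .seq c₁ c₂ => c₁.maxCost + c₂.maxCost
  | .ite b c₁ c₂ => b.cost + 1 + (c₁.maxCost + c₂.maxCost)
  | .loop _ _ => 0

theorem Run.of_loopFree {c : Cmd} (hc : c.loopFree = true) (s : State) :
    Run c s c.maxCost fun s' => s' = c.result s := by
  induction c generalizing s with
  | skip => exact ⟨_, _, .skip s, le_rfl, rfl⟩
  | iset v e => exact ⟨_, _, .iset s v e, le_rfl, rfl⟩
  | rset v e => exact ⟨_, _, .rset s v e, le_rfl, rfl⟩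
  | iput a r c e => exact ⟨_, _, .iput s a r c e, le_rfl, rfl⟩
  | rput a r c e => exact ⟨_, _, .rput s a r c e, le_rfl, rfl⟩
  | seq c₁ c₂ h₁ h₂ =>
    simp only [Cmd.loopFree, Bool.and_eq_true] at hc
    exact (h₁ hc.1 s).seq fun s' _ e => e ▸ h₂ hc.2 _
  | ite b c₁ c₂ h₁ h₂ =>
    simp only [Cmd.loopFree, Bool.and_eq_true] at hc
    by_cases hb : b.holds s
    · obtain ⟨s', k, he, hk, hq⟩ := h₁ hc.1 s
      refine ⟨s', _, .ite_true hb he, by simp only [Cmd.maxCost]; omega, ?_⟩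
      simp [Cmd.result, hb, hq]
    · obtain ⟨s', k, he, hk, hq⟩ := h₂ hc.2 s
      refine ⟨s', _, .ite_false hb he, by simp only [Cmd.maxCost]; omega, ?_⟩
      simp [Cmd.result, hb, hq]
  | loop b c => simp [Cmd.loopFree] at hc

theorem Run.of_result {c : Cmd} {s : State} {K : ℕ} {Q : State → Prop} (hc : c.loopFree = true)
    (hK : c.maxCost ≤ K) (h : Q (c.result s)) : Run c s K Q :=
  (Run.of_loopFree hc s).mono hK fun _ _ e => e ▸ h

section Memory

variable (s : State)

@[simp] theorem State.setI_ivar (v k w : ℕ) :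
    (s.setI v k).ivar w = if w = v then k else s.ivar w := by
  simp [State.setI, Function.update_apply]

@[simp] theorem State.setI_rvar (v k : ℕ) : (s.setI v k).rvar = s.rvar := rfl
@[simp] theorem State.setI_iarr (v k : ℕ) : (s.setI v k).iarr = s.iarr := rfl
@[simp] theorem State.setI_rarr (v k : ℕ) : (s.setI v k).rarr = s.rarr := rfl

@[simp] theorem State.setR_rvar (v w : ℕ) (r : ℝ) :
    (s.setR v r).rvar w = if w = v then r else s.rvar w := by
  simp [State.setR, Function.update_apply]

@[simp] theorem State.setR_ivar (v : ℕ) (r : ℝ) : (s.setR v r).ivar = s.ivar := rfl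
@[simp] theorem State.setR_iarr (v : ℕ) (r : ℝ) : (s.setR v r).iarr = s.iarr := rfl
@[simp] theorem State.setR_rarr (v : ℕ) (r : ℝ) : (s.setR v r).rarr = s.rarr := rfl

@[simp] theorem State.putI_iarr (a i j k a' i' j' : ℕ) :
    (s.putI a i j k).iarr a' i' j' =
      if a' = a ∧ i' = i ∧ j' = j then k else s.iarr a' i' j' := by
  by_cases h : a' = a
  · subst h
    by_cases h' : i' = i
    · subst h'; simp [State.putI, Function.update_apply]
    · simp [State.putI, h']
  · simp [State.putI, h]

@[simp] theorem State.putI_ivar (a i j k : ℕ) : (s.putI a i j k).ivar = s.ivar := rfl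
@[simp] theorem State.putI_rvar (a i j k : ℕ) : (s.putI a i j k).rvar = s.rvar := rfl
@[simp] theorem State.putI_rarr (a i j k : ℕ) : (s.putI a i j k).rarr = s.rarr := rfl

@[simp] theorem State.putR_rarr (a i j a' i' j' : ℕ) (r : ℝ) :
    (s.putR a i j r).rarr a' i' j' =
      if a' = a ∧ i' = i ∧ j' = j then r else s.rarr a' i' j' := by
  by_cases h : a' = a
  · subst h
    by_cases h' : i' = i
    · subst h'; simp [State.putR, Function.update_apply]
    · simp [State.putR, h']
  · simp [State.putR, h]

@[simp] theorem State.putR_ivar (a i j : ℕ) (r : ℝ) : (s.putR a i j r).ivar = s.ivar := rfl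
@[simp] theorem State.putR_rvar (a i j : ℕ) (r : ℝ) : (s.putR a i j r).rvar = s.rvar := rfl
@[simp] theorem State.putR_iarr (a i j : ℕ) (r : ℝ) : (s.putR a i j r).iarr = s.iarr := rfl

end Memory

end RealRAM

namespace LiF

/-! ### The Hungarian method -/

/-- `p j` is the row matched to the column `j < n`, or `n` if `j` is free. The rows below `i` are
matched, along edges that are tight for the feasible dual solution `(a, b)`. -/
structure IsTightMatching (n i : ℕ) (W : ℕ → ℕ → ℝ) (a b : ℕ → ℝ) (p : ℕ → ℕ) : Prop where
  feas : ∀ r < n, ∀ j < n, W r j ≤ a r + b j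
  tight : ∀ j < n, p j < n → a (p j) + b j = W (p j) j
  inj : ∀ j < n, ∀ j' < n, p j < n → p j = p j' → j = j'
  range : ∀ j < n, p j < i ∨ p j = n
  cover : ∀ r < i, ∃ j < n, p j = r

theorem IsTightMatching.exists_free {n i : ℕ} {W : ℕ → ℕ → ℝ} {a b : ℕ → ℝ} {p : ℕ → ℕ}
    (h : IsTightMatching n i W a b p) (hi : i < n) : ∃ j < n, p j = n := by
  by_contra hcon
  push Not at hcon
  have hlt : ∀ j < n, p j < i := fun j hj => (h.range j hj).resolve_right (hcon j hj)
  have := Finset.card_le_card_of_injOn p (s := Finset.range n) (t := Finset.range i)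
    (fun j hj => by
      have := hlt j (by simpa using hj)
      simpa using this)
    (fun j hj j' hj' e => by
      have hj := Finset.mem_range.1 (Finset.mem_coe.1 hj)
      have hj' := Finset.mem_range.1 (Finset.mem_coe.1 hj')
      exact h.inj j hj j' hj' ((hlt j hj).trans hi) e)
  simp at this
  omega

theorem IsTightMatching.congr {n i : ℕ} {W : ℕ → ℕ → ℝ} {a b : ℕ → ℝ} {p p' : ℕ → ℕ}
    (h : IsTightMatching n i W a b p) (hp : ∀ j < n, p' j = p j) :
    IsTightMatching n i W a b p' where
  feas := h.feas
  tight j hj := by rw [hp j hj]; exact h.tight j hj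
  inj j hj j' hj' := by rw [hp j hj, hp j' hj']; exact h.inj j hj j' hj'
  range j hj := by rw [hp j hj]; exact h.range j hj
  cover r hr := by
    obtain ⟨j, hj, e⟩ := h.cover r hr
    exact ⟨j, hj, by rw [hp j hj, e]⟩

theorem IsTightMatching.eq_of_eq {n i : ℕ} {W : ℕ → ℕ → ℝ} {a b : ℕ → ℝ} {p : ℕ → ℕ}
    (h : IsTightMatching n i W a b p) (hi : i < n) (hp : p n = i) :
    ∀ j ≤ n, ∀ j' ≤ n, p j < n → p j = p j' → j = j' := by
  intro j hj j' hj' hlt e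
  rcases hj.lt_or_eq with hj | rfl <;> rcases hj'.lt_or_eq with hj' | rfl
  · exact h.inj j hj j' hj' hlt e
  · have := h.range j hj; omega
  · have := h.range j' hj'; omega
  · rfl

/-- The alternating tree at the head of the growing loop. The tree columns are those of nonzero
`rank` (the column `n` stands for the root row `p n`); `j₀` is the column about to join. -/
structure IsTree (n : ℕ) (W : ℕ → ℕ → ℝ) (a b minv : ℕ → ℝ) (p way rank : ℕ → ℕ)
    (cnt j₀ : ℕ) : Prop where
  rank_le : ∀ j ≤ n, rank j ≤ cnt
  matched : ∀ j ≤ n, rank j ≠ 0 → p j < n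
  lower : ∀ j < n, rank j = 0 → ∀ j' ≤ n, rank j' ≠ 0 →
    way j ≤ n ∧ minv j ≤ a (p j') + b j - W (p j') j
  attained : ∀ j < n, rank j = 0 → way j ≤ n →
    rank (way j) ≠ 0 ∧ minv j = a (p (way j)) + b j - W (p (way j)) j
  tree : ∀ j < n, rank j ≠ 0 → way j ≤ n ∧ rank (way j) ≠ 0 ∧ rank (way j) < rank j ∧
    a (p (way j)) + b j = W (p (way j)) j
  head_le : j₀ ≤ n
  head_rank : rank j₀ = 0
  head_way : j₀ = n ∨ rank n ≠ 0 ∧ way j₀ ≤ n ∧ rank (way j₀) ≠ 0 ∧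
    a (p (way j₀)) + b j₀ = W (p (way j₀)) j₀

/-- The alternating tree after a column has joined and the slacks `minv` have been lowered. -/
structure IsGrownTree (n : ℕ) (W : ℕ → ℕ → ℝ) (a b minv : ℕ → ℝ) (p way rank : ℕ → ℕ)
    (cnt : ℕ) : Prop where
  rank_le : ∀ j ≤ n, rank j ≤ cnt
  matched : ∀ j ≤ n, rank j ≠ 0 → p j < n
  root : rank n ≠ 0
  lower : ∀ j < n, rank j = 0 → ∀ j' ≤ n, rank j' ≠ 0 → minv j ≤ a (p j') + b j - W (p j') j
  attained : ∀ j < n, rank j = 0 → way j ≤ n ∧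
    rank (way j) ≠ 0 ∧ minv j = a (p (way j)) + b j - W (p (way j)) j
  tree : ∀ j < n, rank j ≠ 0 → way j ≤ n ∧ rank (way j) ≠ 0 ∧ rank (way j) < rank j ∧
    a (p (way j)) + b j = W (p (way j)) j

variable {n i cnt j₀ : ℕ} {W : ℕ → ℕ → ℝ} {a b minv a' b' minv' : ℕ → ℝ}
  {p way rank way' rank' : ℕ → ℕ}

theorem IsTree.init (hr : ∀ j ≤ n, rank j = 0) (hw : ∀ j ≤ n, way j = n + 1) :
    IsTree n W a b minv p way rank 0 n where
  rank_le j hj := (hr j hj).le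
  matched j hj h := absurd (hr j hj) h
  lower j _ _ j' hj' h := absurd (hr j' hj') h
  attained j hj _ h := by have := hw j hj.le; omega
  tree j hj h := absurd (hr j hj.le) h
  head_le := le_rfl
  head_rank := hr n le_rfl
  head_way := Or.inl rfl

theorem IsTree.grow (h : IsTree n W a b minv p way rank cnt j₀) (hp : p j₀ < n)
    (hrank : ∀ j, rank' j = if j = j₀ then cnt + 1 else rank j)
    (hminv : ∀ j < n, minv' j =
      if rank' j = 0 ∧ ¬ (way j ≤ n ∧ minv j ≤ a (p j₀) + b j - W (p j₀) j)
      then a (p j₀) + b j - W (p j₀) j else minv j)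
    (hway : ∀ j < n, way' j =
      if rank' j = 0 ∧ ¬ (way j ≤ n ∧ minv j ≤ a (p j₀) + b j - W (p j₀) j)
      then j₀ else way j) :
    IsGrownTree n W a b minv' p way' rank' (cnt + 1) := by
  have hr0 := h.head_rank
  have hne : ∀ j, rank' j ≠ 0 → j = j₀ ∨ rank j ≠ 0 ∧ j ≠ j₀ := by
    intro j hj
    rw [hrank] at hj
    by_cases e : j = j₀
    · exact Or.inl e
    · rw [if_neg e] at hj; exact Or.inr ⟨hj, e⟩
  have hpos : ∀ j, rank j ≠ 0 → rank' j = rank j := by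
    intro j hj
    rw [hrank, if_neg]
    rintro rfl; exact hj hr0
  have hpos' : ∀ j, rank j ≠ 0 → rank' j ≠ 0 := fun j hj => by rw [hpos j hj]; exact hj
  have hj0 : rank' j₀ = cnt + 1 := by rw [hrank, if_pos rfl]
  have hun : ∀ j, rank' j = 0 → rank j = 0 ∧ j ≠ j₀ := by
    intro j hj
    rw [hrank] at hj
    by_cases e : j = j₀
    · simp [e] at hj
    · rw [if_neg e] at hj; exact ⟨hj, e⟩
  have hwr : ∀ j < n, rank' j ≠ 0 → way' j = way j := by
    intro j hj hjr
    rw [hway j hj, if_neg]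
    exact fun hh => hjr hh.1
  refine ⟨fun j hj => ?_, fun j hj hjr => ?_, ?_, fun j hj hjr j' hj' hjr' => ?_,
    fun j hj hjr => ?_, fun j hj hjr => ?_⟩
  · rw [hrank]
    have := h.rank_le j hj
    split_ifs <;> omega
  · rcases hne j hjr with rfl | hh
    · exact hp
    · exact h.matched j hj hh.1
  · rcases h.head_way with e | e
    · rw [← e, hj0]; omega
    · exact hpos' n e.1
  · obtain ⟨hjr0, hjne⟩ := hun j hjr
    rw [hminv j hj]
    have hl : ∀ j' ≤ n, rank j' ≠ 0 → _ := h.lower j hj hjr0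
    split_ifs with hc
    · rcases hne j' hjr' with rfl | hh
      · exact le_rfl
      · have h1 := hl j' hj' hh.1
        have h2 : ¬ (minv j ≤ a (p j₀) + b j - W (p j₀) j) := fun hx => hc.2 ⟨h1.1, hx⟩
        exact (not_le.1 h2).le.trans h1.2
    · rcases hne j' hjr' with rfl | hh
      · have h2 := not_not.1 fun hx => hc ⟨hjr, hx⟩
        exact h2.2
      · exact (hl j' hj' hh.1).2
  · obtain ⟨hjr0, hjne⟩ := hun j hjr
    rw [hminv j hj, hway j hj]
    split_ifs with hc
    · exact ⟨h.head_le, by rw [hj0]; omega, rfl⟩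
    · have h2 := not_not.1 fun hx => hc ⟨hjr, hx⟩
      have h3 := h.attained j hj hjr0 h2.1
      exact ⟨h2.1, hpos' _ h3.1, h3.2⟩
  · rw [hwr j hj hjr]
    rcases hne j hjr with rfl | hh
    · rcases h.head_way with e | e
      · omega
      · refine ⟨e.2.1, hpos' _ e.2.2.1, ?_, e.2.2.2⟩
        rw [hpos _ e.2.2.1, hj0]
        have := h.rank_le _ e.2.1
        omega
    · have h3 := h.tree j hj hh.1
      refine ⟨h3.1, hpos' _ h3.2.1, ?_, h3.2.2.2⟩
      rw [hpos _ h3.2.1, hpos _ hh.1]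
      exact h3.2.2.1

/-- The effect of a dual update by `δ`. -/
structure IsDualShift (n : ℕ) (δ : ℝ) (p rank : ℕ → ℕ) (a b minv a' b' minv' : ℕ → ℝ) :
    Prop where
  rows : ∀ r, a' r = if ∃ j ≤ n, rank j ≠ 0 ∧ p j = r then a r - δ else a r
  cols : ∀ j ≤ n, b' j = if rank j ≠ 0 then b j + δ else b j
  slacks : ∀ j ≤ n, minv' j = if rank j ≠ 0 then minv j else minv j - δ

theorem IsDualShift.row_of_tree {δ : ℝ} (hs : IsDualShift n δ p rank a b minv a' b' minv') {j : ℕ}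
    (hj : j ≤ n) (hr : rank j ≠ 0) : a' (p j) = a (p j) - δ := by
  rw [hs.rows, if_pos ⟨j, hj, hr, rfl⟩]

theorem IsTightMatching.dualShift {δ : ℝ} (h : IsTightMatching n i W a b p) (hi : i < n)
    (hp : p n = i) (ht : IsGrownTree n W a b minv p way rank cnt)
    (hs : IsDualShift n δ p rank a b minv a' b' minv') (hδ0 : 0 ≤ δ)
    (hδ : ∀ j < n, rank j = 0 → δ ≤ minv j) : IsTightMatching n i W a' b' p where
  feas r hr j hj := by
    have hf := h.feas r hr j hj
    rw [hs.rows, hs.cols j hj.le]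
    by_cases hj0 : rank j = 0
    · rw [if_neg (not_not.2 hj0)]
      split_ifs with hx
      · obtain ⟨j', hj', hr', rfl⟩ := hx
        have := ht.lower j hj hj0 j' hj' hr'
        have := hδ j hj hj0
        linarith
      · exact hf
    · rw [if_pos hj0]
      split_ifs <;> linarith
  tight j hj hlt := by
    have hf := h.tight j hj hlt
    by_cases hj0 : rank j = 0
    · rw [hs.rows, if_neg, hs.cols j hj.le, if_neg (not_not.2 hj0), hf]
      rintro ⟨j', hj', hr', e⟩
      have := h.eq_of_eq hi hp j hj.le j' hj' hlt e.symm
      subst this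
      exact hr' hj0
    · rw [hs.row_of_tree hj.le hj0, hs.cols j hj.le, if_pos hj0, ← hf]
      ring
  inj := h.inj
  range := h.range
  cover := h.cover

theorem IsGrownTree.dualShift {j₁ : ℕ} (ht : IsGrownTree n W a b minv p way rank cnt)
    (hs : IsDualShift n (minv j₁) p rank a b minv a' b' minv') (hj₁ : j₁ < n)
    (hr₁ : rank j₁ = 0) : IsTree n W a' b' minv' p way rank cnt j₁ where
  rank_le := ht.rank_le
  matched := ht.matched
  lower j hj hj0 j' hj' hr' := by
    refine ⟨(ht.attained j hj hj0).1, ?_⟩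
    rw [hs.slacks j hj.le, hs.row_of_tree hj' hr', hs.cols j hj.le, if_neg (not_not.2 hj0),
      if_neg (not_not.2 hj0)]
    have := ht.lower j hj hj0 j' hj' hr'
    linarith
  attained j hj hj0 hw := by
    have h3 := ht.attained j hj hj0
    refine ⟨h3.2.1, ?_⟩
    rw [hs.slacks j hj.le, hs.row_of_tree hw h3.2.1, hs.cols j hj.le, if_neg (not_not.2 hj0),
      if_neg (not_not.2 hj0), h3.2.2]
    ring
  tree j hj hr := by
    have h3 := ht.tree j hj hr
    refine ⟨h3.1, h3.2.1, h3.2.2.1, ?_⟩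
    rw [hs.row_of_tree h3.1 h3.2.1, hs.cols j hj.le, if_pos hr, ← h3.2.2.2]
    ring
  head_le := hj₁.le
  head_rank := hr₁
  head_way := by
    have h3 := ht.attained j₁ hj₁ hr₁
    refine Or.inr ⟨ht.root, h3.1, h3.2.1, ?_⟩
    rw [hs.row_of_tree h3.1 h3.2.1, hs.cols j₁ hj₁.le, if_neg (not_not.2 hr₁), h3.2.2]
    ring

/-- The matching while it is changed along the tree path from a free column to the root: the column
`h` is about to be matched anew. -/
structure IsAugmenting (n i : ℕ) (W : ℕ → ℕ → ℝ) (a b : ℕ → ℝ) (way rank p : ℕ → ℕ) (h : ℕ) :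
    Prop where
  head_le : h ≤ n
  head_rank : rank h ≠ 0
  tight : ∀ j < n, j ≠ h → p j < n → a (p j) + b j = W (p j) j
  inj : ∀ j ≤ n, ∀ j' ≤ n, j ≠ h → j' ≠ h → p j < n → p j = p j' → j = j'
  range : ∀ j ≤ n, j ≠ h → p j < i ∨ p j = n
  cover : ∀ r < i, ∃ j ≤ n, j ≠ h ∧ p j = r
  path : ∀ j < n, rank j ≠ 0 → rank j ≤ rank h → way j ≤ n ∧ rank (way j) ≠ 0 ∧
    rank (way j) < rank j ∧ p (way j) < n ∧ a (p (way j)) + b j = W (p (way j)) j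

theorem IsTree.isAugmenting (h : IsTightMatching n i W a b p) (hi : i < n) (hp : p n = i)
    (ht : IsTree n W a b minv p way rank cnt j₀) (hj₀ : ¬ p j₀ < n)
    (hrank : ∀ j, rank' j = if j = j₀ then cnt + 1 else rank j) :
    IsAugmenting n (i + 1) W a b way rank' p j₀ := by
  have hj₀n : j₀ ≠ n := by rintro rfl; omega
  have hw := ht.head_way.resolve_left hj₀n
  have hpos : ∀ j, rank j ≠ 0 → rank' j = rank j := by
    intro j hj
    rw [hrank, if_neg]
    rintro rfl; exact hj ht.head_rank
  refine ⟨ht.head_le, ?_, fun j hj _ => h.tight j hj, fun j hj j' hj' _ _ => h.eq_of_eq hi hp j hj j' hj',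
    fun j hj _ => ?_, fun r hr => ?_, fun j hj hr _ => ?_⟩
  · rw [hrank, if_pos rfl]; omega
  · rcases hj.lt_or_eq with hj | rfl
    · have := h.range j hj; omega
    · omega
  · rcases Nat.lt_succ_iff_lt_or_eq.1 hr with hr | rfl
    · obtain ⟨j, hj, e⟩ := h.cover r hr
      exact ⟨j, hj.le, by rintro rfl; omega, e⟩
    · exact ⟨n, le_rfl, hj₀n.symm, hp⟩
  · by_cases e : j = j₀
    · subst e
      refine ⟨hw.2.1, by rw [hpos _ hw.2.2.1]; exact hw.2.2.1, ?_, ht.matched _ hw.2.1 hw.2.2.1,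
        hw.2.2.2⟩
      rw [hpos _ hw.2.2.1, hrank j, if_pos rfl]
      have := ht.rank_le _ hw.2.1
      omega
    · rw [hrank, if_neg e] at hr
      have h3 := ht.tree j hj hr
      refine ⟨h3.1, by rw [hpos _ h3.2.1]; exact h3.2.1, ?_, ht.matched _ h3.1 h3.2.1, h3.2.2.2⟩
      rw [hpos _ h3.2.1, hpos _ hr]
      exact h3.2.2.1

theorem IsAugmenting.step {h : ℕ} {p' : ℕ → ℕ} (ha : IsAugmenting n i W a b way rank p h)
    (hn : h < n) (hp' : ∀ j, p' j = if j = h then p (way h) else p j) :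
    IsAugmenting n i W a b way rank p' (way h) ∧ rank (way h) < rank h := by
  obtain ⟨h1, h2, h3, h4, h5⟩ := ha.path h hn ha.head_rank le_rfl
  have hne : way h ≠ h := by intro e; rw [e] at h3; omega
  refine ⟨⟨h1, h2, fun j hj hjw => ?_, fun j hj j' hj' hjw hjw' => ?_, fun j hj hjw => ?_,
    fun r hr => ?_, fun j hj hr hle => ?_⟩, h3⟩
  · rw [hp']
    split_ifs with e
    · subst e; exact fun _ => h5
    · exact ha.tight j hj e
  · rw [hp', hp']
    split_ifs with e e' e'
    · intros; rw [e, e']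
    · intro hlt he
      exact absurd (ha.inj _ h1 j' hj' hne e' hlt he).symm hjw'
    · intro hlt he
      exact absurd (ha.inj j hj _ h1 e hne hlt he) hjw
    · exact ha.inj j hj j' hj' e e'
  · rw [hp']
    split_ifs with e
    · exact ha.range _ h1 hne
    · exact ha.range j hj e
  · obtain ⟨j, hj, hjh, e⟩ := ha.cover r hr
    by_cases hjw : j = way h
    · exact ⟨h, hn.le, hne.symm, by rw [hp', if_pos rfl, ← hjw, e]⟩
    · exact ⟨j, hj, hjw, by rw [hp', if_neg hjh, e]⟩
  · obtain ⟨g1, g2, g3, g4, g5⟩ := ha.path j hj hr (by omega)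
    have hwj : way j ≠ h := by intro e; rw [e] at g3; omega
    rw [hp', if_neg hwj]
    exact ⟨g1, g2, g3, g4, g5⟩

theorem IsAugmenting.isTightMatching (ha : IsAugmenting n i W a b way rank p n)
    (hfeas : ∀ r < n, ∀ j < n, W r j ≤ a r + b j) : IsTightMatching n i W a b p where
  feas := hfeas
  tight j hj := ha.tight j hj hj.ne
  inj j hj j' hj' := ha.inj j hj.le j' hj'.le hj.ne hj'.ne
  range j hj := ha.range j hj.le hj.ne
  cover r hr := by
    obtain ⟨j, hj, hne, e⟩ := ha.cover r hr
    exact ⟨j, lt_of_le_of_ne hj hne, e⟩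

/-- The permutation given by a complete tight matching. -/
theorem IsTightMatching.exists_perm (h : IsTightMatching n n W a b p) :
    ∃ σ : Equiv.Perm (Fin n), (∀ i j : Fin n, σ i = j ↔ p j = i) ∧
      ∀ i : Fin n, W i (σ i) = a i + b (σ i) := by
  have hlt : ∀ j < n, p j < n := by
    have hsurj : Function.Surjective
        (fun j : Fin n => if hj : p j < n then (⟨p j, hj⟩ : Fin n) else j) := by
      intro r
      obtain ⟨j, hj, e⟩ := h.cover r r.2
      refine ⟨⟨j, hj⟩, ?_⟩
      have : p j < n := by rw [e]; exact r.2
      simp [e]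
    intro j hj
    by_contra hcon
    obtain ⟨j', hj', e⟩ := h.cover j hj
    have hinj := Finite.injective_iff_surjective.2 hsurj
    have hp' : p j' < n := by omega
    have := @hinj ⟨j, hj⟩ ⟨j', hj'⟩ (by simp [hcon, e, hj])
    simp at this
    subst this
    omega
  have hbij : Function.Bijective (fun j : Fin n => (⟨p j, hlt j j.2⟩ : Fin n)) := by
    refine Finite.injective_iff_bijective.1 fun j j' e => ?_
    simp at e
    exact Fin.ext (h.inj j j.2 j' j'.2 (hlt j j.2) e)
  set τ := Equiv.ofBijective _ hbij
  have hτ : ∀ j : Fin n, ((τ j : Fin n) : ℕ) = p j := fun j => rfl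
  have hiff : ∀ i j : Fin n, τ.symm i = j ↔ p j = i := by
    intro i j
    rw [Equiv.symm_apply_eq, ← hτ]
    exact ⟨fun e => by rw [e], fun e => (Fin.ext e).symm⟩
  refine ⟨τ.symm, hiff, fun i => ?_⟩
  have h1 := (hiff i (τ.symm i)).1 rfl
  have h2 := h.tight (τ.symm i) (τ.symm i).2 (hlt _ (τ.symm i).2)
  rw [h1] at h2
  exact h2.symm

end LiF

namespace LiF

open RealRAM

/-! ### A program for the Hungarian method

Memory layout: the index variables `0, …, 7` hold `n`, `t`, the row `i`, the loop counter `j`, the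
head `j₀` of the tree, the next column, the number of tree columns and the row of `j₀`; the real
arrays `0, …, 5` hold `u`, `x`, the weights, the row and column duals and the slacks; the index
arrays `0, 1, 2` hold the matching, the tree edges and the ranks. Vectors occupy row `0`. -/

/-- The entry `e` of the index vector `a`. -/
abbrev ivec (a : ℕ) (e : IExpr) : IExpr := .get a (.const 0) e

/-- The entry `e` of the real vector `a`. -/
abbrev rvec (a : ℕ) (e : IExpr) : RExpr := .get a (.const 0) e

/-- Empty the tree. -/
def clearTree : Cmd :=
  forLoop 3 (.add (.var 0) (.const 1))
    (.seq (.iput 2 (.const 0) (.var 3) (.const 0))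
      (.iput 1 (.const 0) (.var 3) (.add (.var 0) (.const 1))))

theorem run_clearTree {n : ℕ} {s₀ : State} (hn : s₀.ivar 0 = n) :
    Run clearTree s₀ ((n + 2) * 100) fun s =>
      ∀ j ≤ n, s.iarr 2 0 j = 0 ∧ s.iarr 1 0 j = n + 1 := by
  refine (Run.forLoop (K := 80) (m := n + 1)
    (fun m s => ∀ j < m, s.iarr 2 0 j = 0 ∧ s.iarr 1 0 j = n + 1) rfl ?_ ?_ ?_).mono ?_ ?_
  · intro s hF
    simp [IExpr.eval, hF.ivar 0 rfl, hn]
  · simp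
  · intro m hm s hF hj hI
    have h0 := hF.ivar 0 rfl
    refine Run.of_result rfl (by decide) ?_
    simp only [Cmd.result, IExpr.eval, hj, State.setI_iarr, State.putI_iarr]
    simp [hj, h0, hn]
    grind
  · exact Nat.mul_le_mul_left _ (by decide)
  · intro s _ h j hj
    exact h j (by omega)

/-- Lower the slacks by means of the row in the index variable `7`. -/
def relax : Cmd :=
  forLoop 3 (.var 0)
    (.ite (.ile (ivec 2 (.var 3)) (.const 0))
      (.seq (.rset 1 (.sub (.add (rvec 3 (.var 7)) (rvec 4 (.var 3))) (.get 2 (.var 7) (.var 3))))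
        (.ite (.not (.and (.ile (ivec 1 (.var 3)) (.var 0)) (.rle (rvec 5 (.var 3)) (.var 1))))
          (.seq (.rput 5 (.const 0) (.var 3) (.var 1)) (.iput 1 (.const 0) (.var 3) (.var 4)))
          .skip))
      .skip)

theorem run_relax {n r j₀ : ℕ} {s₀ : State} (hn : s₀.ivar 0 = n) (hr : s₀.ivar 7 = r)
    (hj₀ : s₀.ivar 4 = j₀) :
    Run relax s₀ ((n + 1) * 100) fun s =>
      (∀ j < n, s.rarr 5 0 j =
        if s₀.iarr 2 0 j = 0 ∧ ¬ (s₀.iarr 1 0 j ≤ n ∧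
          s₀.rarr 5 0 j ≤ s₀.rarr 3 0 r + s₀.rarr 4 0 j - s₀.rarr 2 r j)
        then s₀.rarr 3 0 r + s₀.rarr 4 0 j - s₀.rarr 2 r j else s₀.rarr 5 0 j) ∧
      (∀ j < n, s.iarr 1 0 j =
        if s₀.iarr 2 0 j = 0 ∧ ¬ (s₀.iarr 1 0 j ≤ n ∧
          s₀.rarr 5 0 j ≤ s₀.rarr 3 0 r + s₀.rarr 4 0 j - s₀.rarr 2 r j)
        then j₀ else s₀.iarr 1 0 j) := by
  refine (Run.forLoop (K := 80) (m := n)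
    (fun m s => (∀ j, s.rarr 5 0 j =
        if j < m ∧ s₀.iarr 2 0 j = 0 ∧ ¬ (s₀.iarr 1 0 j ≤ n ∧
          s₀.rarr 5 0 j ≤ s₀.rarr 3 0 r + s₀.rarr 4 0 j - s₀.rarr 2 r j)
        then s₀.rarr 3 0 r + s₀.rarr 4 0 j - s₀.rarr 2 r j else s₀.rarr 5 0 j) ∧
      (∀ j, s.iarr 1 0 j =
        if j < m ∧ s₀.iarr 2 0 j = 0 ∧ ¬ (s₀.iarr 1 0 j ≤ n ∧
          s₀.rarr 5 0 j ≤ s₀.rarr 3 0 r + s₀.rarr 4 0 j - s₀.rarr 2 r j)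
        then j₀ else s₀.iarr 1 0 j)) rfl ?_ ?_ ?_).mono ?_ ?_
  · intro s hF
    simp [IExpr.eval, hF.ivar 0 rfl, hn]
  · simp
  · intro m hm s hF hj ⟨hI1, hI2⟩
    have h0 := hF.ivar 0 rfl
    have h7 := hF.ivar 7 rfl
    have h4 := hF.ivar 4 rfl
    have hrank := hF.iarr 2 rfl
    have hW := hF.rarr 2 rfl
    have ha := hF.rarr 3 rfl
    have hb := hF.rarr 4 rfl
    rw [hn] at h0
    rw [hr] at h7
    rw [hj₀] at h4
    have e1 := hI1 m
    have e2 := hI2 m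
    simp only [lt_self_iff_false, false_and, if_false] at e1 e2
    refine Run.of_result rfl (by decide) ?_
    simp only [Cmd.result, IExpr.eval, RExpr.eval, BExpr.holds, hj, hrank, hW, ha, hb, h0, h7,
      State.setR_ivar, State.setR_rvar, State.setR_iarr, State.setR_rarr, if_true, e1, e2,
      Nat.le_zero]
    split_ifs with c1 c2
    all_goals
      simp only [State.setI_rarr, State.setI_iarr, State.putI_rarr, State.putR_rarr,
        State.putI_iarr, State.putR_iarr, State.setR_rarr, State.setR_iarr,
        State.putR_ivar, State.setR_ivar, hj, h4, true_and]
      grind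
  · exact Nat.mul_le_mul_left _ (by decide)
  · intro s _ h
    constructor
    · intro j hj
      rw [h.1 j]
      simp [hj]
    · intro j hj
      rw [h.2 j]
      simp [hj]

/-- Find a column of least slack outside the tree. -/
def select : Cmd :=
  forLoop 3 (.var 0)
    (.ite (.and (.ile (ivec 2 (.var 3)) (.const 0))
        (.not (.and (.ile (.var 5) (.var 0)) (.rle (.var 2) (rvec 5 (.var 3))))))
      (.seq (.rset 2 (rvec 5 (.var 3))) (.iset 5 (.var 3)))
      .skip)

theorem run_select {n : ℕ} {s₀ : State} (hn : s₀.ivar 0 = n) (h5 : s₀.ivar 5 = n + 1)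
    (hfree : ∃ j < n, s₀.iarr 2 0 j = 0) :
    Run select s₀ ((n + 1) * 100) fun s =>
      s.ivar 5 < n ∧ s₀.iarr 2 0 (s.ivar 5) = 0 ∧ s.rvar 2 = s₀.rarr 5 0 (s.ivar 5) ∧
        ∀ j < n, s₀.iarr 2 0 j = 0 → s₀.rarr 5 0 (s.ivar 5) ≤ s₀.rarr 5 0 j := by
  refine (Run.forLoop (K := 80) (m := n)
    (fun m s => (s.ivar 5 = n + 1 ∧ ∀ j < m, s₀.iarr 2 0 j ≠ 0) ∨
      (s.ivar 5 < n ∧ s₀.iarr 2 0 (s.ivar 5) = 0 ∧ s.rvar 2 = s₀.rarr 5 0 (s.ivar 5) ∧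
        ∀ j < m, s₀.iarr 2 0 j = 0 → s₀.rarr 5 0 (s.ivar 5) ≤ s₀.rarr 5 0 j))
    rfl ?_ ?_ ?_).mono ?_ ?_
  · intro s hF
    simp [IExpr.eval, hF.ivar 0 rfl, hn]
  · simp [h5]
  · intro m hm s hF hj hI
    have h0 := hF.ivar 0 rfl
    have hrank := hF.iarr 2 rfl
    have hminv := hF.rarr 5 rfl
    rw [hn] at h0
    refine Run.of_result rfl (by decide) ?_
    simp only [Cmd.result, IExpr.eval, RExpr.eval, BExpr.holds, hj, hrank, hminv, h0, Nat.le_zero]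
    split_ifs with c1
    · simp [hj]
      right
      refine ⟨hm, c1.1, fun j hjm hj0 => ?_⟩
      rcases hI with hI | hI
      · have := hI.2 j; grind
      · have := hI.2.2.2 j; grind
    · simp
      rcases hI with hI | hI
      · left; grind
      · right
        refine ⟨hI.1, hI.2.1, hI.2.2.1, fun j hjm hj0 => ?_⟩
        have := hI.2.2.2 j; grind
  · exact Nat.mul_le_mul_left _ (by decide)
  · rintro s _ (h | h)
    · obtain ⟨j, hj, e⟩ := hfree
      exact absurd e (h.2 j hj)
    · exact h

/-- Change the duals by the amount in the real variable `2`. -/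
def shift : Cmd :=
  forLoop 3 (.add (.var 0) (.const 1))
    (.ite (.ile (ivec 2 (.var 3)) (.const 0))
      (.rput 5 (.const 0) (.var 3) (.sub (rvec 5 (.var 3)) (.var 2)))
      (.seq (.rput 3 (.const 0) (ivec 0 (.var 3)) (.sub (rvec 3 (ivec 0 (.var 3))) (.var 2)))
        (.rput 4 (.const 0) (.var 3) (.add (rvec 4 (.var 3)) (.var 2)))))

theorem run_shift {n : ℕ} {s₀ : State} (hn : s₀.ivar 0 = n)
    (hinj : ∀ j ≤ n, ∀ j' ≤ n, s₀.iarr 2 0 j ≠ 0 → s₀.iarr 0 0 j = s₀.iarr 0 0 j' → j = j') :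
    Run shift s₀ ((n + 2) * 100) fun s =>
      IsDualShift n (s₀.rvar 2) (s₀.iarr 0 0) (s₀.iarr 2 0) (s₀.rarr 3 0) (s₀.rarr 4 0)
        (s₀.rarr 5 0) (s.rarr 3 0) (s.rarr 4 0) (s.rarr 5 0) := by
  refine (Run.forLoop (K := 80) (m := n + 1)
    (fun m s => (∀ r, s.rarr 3 0 r =
        if ∃ j < m, s₀.iarr 2 0 j ≠ 0 ∧ s₀.iarr 0 0 j = r then s₀.rarr 3 0 r - s₀.rvar 2
        else s₀.rarr 3 0 r) ∧
      (∀ j, s.rarr 4 0 j = if j < m ∧ s₀.iarr 2 0 j ≠ 0 then s₀.rarr 4 0 j + s₀.rvar 2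
        else s₀.rarr 4 0 j) ∧
      (∀ j, s.rarr 5 0 j = if j < m ∧ s₀.iarr 2 0 j = 0 then s₀.rarr 5 0 j - s₀.rvar 2
        else s₀.rarr 5 0 j))
    rfl ?_ ?_ ?_).mono ?_ ?_
  · intro s hF
    simp [IExpr.eval, hF.ivar 0 rfl, hn]
  · simp
  · intro m hm s hF hj ⟨hI1, hI2, hI3⟩
    have hrank := hF.iarr 2 rfl
    have hp := hF.iarr 0 rfl
    have hδ := hF.rvar 2 rfl
    have e2 := hI2 m
    have e3 := hI3 m
    simp only [lt_self_iff_false, false_and, if_false] at e2 e3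
    refine Run.of_result rfl (by decide) ?_
    simp only [Cmd.result, IExpr.eval, RExpr.eval, BExpr.holds, hj, hrank, hp, hδ, Nat.le_zero,
      State.putR_ivar, State.putR_rvar, e3]
    split_ifs with c1
    · simp only [State.setI_rarr, State.putR_rarr]
      refine ⟨fun r => ?_, fun j => ?_, fun j => ?_⟩
      · simp only [Nat.reduceEqDiff, false_and, if_false, hI1 r]
        have : (∃ j < m, s₀.iarr 2 0 j ≠ 0 ∧ s₀.iarr 0 0 j = r) ↔
            ∃ j < m + 1, s₀.iarr 2 0 j ≠ 0 ∧ s₀.iarr 0 0 j = r := by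
          constructor
          · rintro ⟨j, hj, h⟩; exact ⟨j, by omega, h⟩
          · rintro ⟨j, hj, h⟩
            exact ⟨j, by grind, h⟩
        simp only [this]
      · grind
      · grind
    · simp only [State.setI_rarr, State.putR_rarr]
      refine ⟨fun r => ?_, fun j => ?_, fun j => ?_⟩
      · simp only [Nat.reduceEqDiff, false_and, if_false, true_and, hI1]
        have hnone : ¬ ∃ j < m, s₀.iarr 2 0 j ≠ 0 ∧ s₀.iarr 0 0 j = s₀.iarr 0 0 m := by
          rintro ⟨j, hj, h, h'⟩
          have := hinj j (by omega) m (by omega) h h'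
          omega
        by_cases hr : r = s₀.iarr 0 0 m
        · rw [if_pos hr, if_neg hnone, if_pos ⟨m, by omega, c1, hr.symm⟩, hr]
        · rw [if_neg hr]
          have : (∃ j < m, s₀.iarr 2 0 j ≠ 0 ∧ s₀.iarr 0 0 j = r) ↔
              ∃ j < m + 1, s₀.iarr 2 0 j ≠ 0 ∧ s₀.iarr 0 0 j = r := by
            constructor
            · rintro ⟨j, hj, h⟩; exact ⟨j, by omega, h⟩
            · rintro ⟨j, hj, h⟩
              exact ⟨j, by grind, h⟩
          simp only [this]
      · grind
      · grind
  · exact Nat.mul_le_mul_left _ (by decide)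
  · rintro s - ⟨h1, h2, h3⟩
    refine ⟨fun r => ?_, fun j hj => ?_, fun j hj => ?_⟩
    · simp only [h1, Nat.lt_succ_iff]
    · rw [h2]; simp [Nat.lt_succ_of_le hj]
    · rw [h3]; grind

/-- Let the column `j₀` join the tree. -/
def joinTree : Cmd :=
  .seq (.iset 6 (.add (.var 6) (.const 1)))
    (.seq (.iput 2 (.const 0) (.var 4) (.var 6)) (.iset 7 (ivec 0 (.var 4))))

theorem run_joinTree (s₀ : State) :
    Run joinTree s₀ 40 fun s => s.ivar 6 = s₀.ivar 6 + 1 ∧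
      s.ivar 7 = s₀.iarr 0 0 (s₀.ivar 4) ∧
      ∀ j, s.iarr 2 0 j = if j = s₀.ivar 4 then s₀.ivar 6 + 1 else s₀.iarr 2 0 j := by
  refine Run.of_result rfl (by decide) ?_
  simp [joinTree, Cmd.result, IExpr.eval]

/-- One round of the growth of the tree. -/
def growTree : Cmd :=
  .seq joinTree (.seq relax (.seq (.iset 5 (.add (.var 0) (.const 1)))
    (.seq select (.seq shift (.iset 4 (.var 5))))))

/-- The invariant of the growth of the tree. -/
structure GrowInv (n i : ℕ) (s : State) : Prop where
  size : s.ivar 0 = n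
  root : s.iarr 0 0 n = i
  matching : IsTightMatching n i (s.rarr 2) (s.rarr 3 0) (s.rarr 4 0) (s.iarr 0 0)
  tree : IsTree n (s.rarr 2) (s.rarr 3 0) (s.rarr 4 0) (s.rarr 5 0) (s.iarr 0 0) (s.iarr 1 0)
    (s.iarr 2 0) (s.ivar 6) (s.ivar 4)
  count : ((Finset.range (n + 1)).filter fun j => s.iarr 2 0 j = 0).card + s.ivar 6 = n + 1

theorem GrowInv.count_le {n i : ℕ} {s : State} (h : GrowInv n i s) : s.ivar 6 ≤ n := by
  have hpos : 0 < ((Finset.range (n + 1)).filter fun j => s.iarr 2 0 j = 0).card := by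
    refine Finset.card_pos.2 ⟨s.ivar 4, ?_⟩
    simp only [Finset.mem_filter, Finset.mem_range, Nat.lt_succ_iff]
    exact ⟨h.tree.head_le, h.tree.head_rank⟩
  have := h.count
  omega

theorem card_filter_update {n c j₀ : ℕ} {rank rank' : ℕ → ℕ} (hj₀ : j₀ ≤ n) (h₀ : rank j₀ = 0)
    (h : ∀ j, rank' j = if j = j₀ then c + 1 else rank j) :
    ((Finset.range (n + 1)).filter fun j => rank' j = 0).card + 1 =
      ((Finset.range (n + 1)).filter fun j => rank j = 0).card := by
  have e : ((Finset.range (n + 1)).filter fun j => rank' j = 0) =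
      ((Finset.range (n + 1)).filter fun j => rank j = 0).erase j₀ := by
    ext j
    simp only [Finset.mem_filter, Finset.mem_erase, h]
    by_cases e : j = j₀ <;> simp [e]
  rw [e, Finset.card_erase_add_one]
  simp [h₀, hj₀]

theorem run_growTree {n i : ℕ} (hi : i < n) {s : State} (h : GrowInv n i s)
    (hp : s.iarr 0 0 (s.ivar 4) < n) :
    Run growTree s ((n + 2) * 400) fun s' =>
      GrowInv n i s' ∧ n + 1 - s'.ivar 6 < n + 1 - s.ivar 6 := by
  have hcnt := h.count_le
  obtain ⟨jf, hjf, hjf'⟩ := h.matching.exists_free hi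
  have hrun := (run_joinTree s).seq (Q := fun s' =>
      GrowInv n i s' ∧ n + 1 - s'.ivar 6 < n + 1 - s.ivar 6)
    (K₂ := (n + 1) * 100 + (5 + ((n + 1) * 100 + ((n + 2) * 100 + 3)))) (c₂ := .seq relax
      (.seq (.iset 5 (.add (.var 0) (.const 1))) (.seq select (.seq shift (.iset 4 (.var 5))))))
    fun s₁ F₁ ⟨h6, h7, hrank⟩ => ?_
  · exact hrun.mono (by omega) fun _ _ h => h
  have n₁ := F₁.ivar 0 rfl
  have j₁ := F₁.ivar 4 rfl
  have p₁ := F₁.iarr 0 rfl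
  have w₁ := F₁.iarr 1 rfl
  have W₁ := F₁.rarr 2 rfl
  have a₁ := F₁.rarr 3 rfl
  have b₁ := F₁.rarr 4 rfl
  have m₁ := F₁.rarr 5 rfl
  refine (run_relax (n₁.trans h.size) h7 j₁).seq fun s₂ F₂ ⟨hminv, hway⟩ => ?_
  rw [W₁, a₁, b₁, m₁, w₁] at hminv hway
  have hg := h.tree.grow hp hrank hminv hway
  refine Run.seq (Run.of_result (K := 5) (Q := fun s' => s'.ivar 5 = n + 1) rfl (by decide) (by
    simp [Cmd.result, IExpr.eval, F₂.ivar 0 rfl, n₁, h.size])) fun s₃ F₃ h5 => ?_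
  have r₃ : s₃.iarr 2 = s₁.iarr 2 := (F₃.iarr 2 rfl).trans (F₂.iarr 2 rfl)
  have n₃ : s₃.ivar 0 = n := (F₃.ivar 0 rfl).trans ((F₂.ivar 0 rfl).trans (n₁.trans h.size))
  have hfree : ∃ j < n, s₃.iarr 2 0 j = 0 := by
    refine ⟨jf, hjf, ?_⟩
    by_contra hne
    rw [r₃] at hne
    have := hg.matched jf hjf.le hne
    omega
  refine (run_select n₃ h5 hfree).seq fun s₄ F₄ ⟨hlt, hun, hval, hmin⟩ => ?_
  have r₄ : s₄.iarr 2 = s₁.iarr 2 := (F₄.iarr 2 rfl).trans r₃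
  have n₄ : s₄.ivar 0 = n := (F₄.ivar 0 rfl).trans n₃
  have p₄ : s₄.iarr 0 = s.iarr 0 := (F₄.iarr 0 rfl).trans ((F₃.iarr 0 rfl).trans
    ((F₂.iarr 0 rfl).trans p₁))
  have a₄ : s₄.rarr 3 = s.rarr 3 := (F₄.rarr 3 rfl).trans ((F₃.rarr 3 rfl).trans
    ((F₂.rarr 3 rfl).trans a₁))
  have b₄ : s₄.rarr 4 = s.rarr 4 := (F₄.rarr 4 rfl).trans ((F₃.rarr 4 rfl).trans
    ((F₂.rarr 4 rfl).trans b₁))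
  have m₃ : s₃.rarr 5 = s₂.rarr 5 := F₃.rarr 5 rfl
  have m₄ : s₄.rarr 5 = s₂.rarr 5 := (F₄.rarr 5 rfl).trans m₃
  rw [r₃] at hun hmin
  rw [m₃] at hval hmin
  have hinj : ∀ j ≤ n, ∀ j' ≤ n, s₄.iarr 2 0 j ≠ 0 → s₄.iarr 0 0 j = s₄.iarr 0 0 j' → j = j' := by
    rw [r₄, p₄]
    intro j hj j' hj' hr
    exact h.matching.eq_of_eq hi h.root j hj j' hj' (hg.matched j hj hr)
  refine (run_shift n₄ hinj).seq fun s₅ F₅ hs => ?_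
  rw [hval, p₄, r₄, a₄, b₄, m₄] at hs
  have hδ0 : 0 ≤ s₂.rarr 5 0 (s₄.ivar 5) := by
    have h3 := hg.attained _ hlt hun
    rw [h3.2.2]
    have := h.matching.feas _ (hg.matched _ h3.1 h3.2.1) _ hlt
    linarith
  have hM := h.matching.dualShift hi h.root hg hs hδ0 hmin
  have hT := hg.dualShift hs hlt hun
  refine Run.of_result rfl (by decide) ?_
  have n₅ : s₅.ivar 0 = n := (F₅.ivar 0 rfl).trans n₄
  have p₅ : s₅.iarr 0 = s.iarr 0 := (F₅.iarr 0 rfl).trans p₄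
  have r₅ : s₅.iarr 2 = s₁.iarr 2 := (F₅.iarr 2 rfl).trans r₄
  have w₅ : s₅.iarr 1 = s₂.iarr 1 := (F₅.iarr 1 rfl).trans ((F₄.iarr 1 rfl).trans (F₃.iarr 1 rfl))
  have W₅ : s₅.rarr 2 = s.rarr 2 := (F₅.rarr 2 rfl).trans ((F₄.rarr 2 rfl).trans
    ((F₃.rarr 2 rfl).trans ((F₂.rarr 2 rfl).trans W₁)))
  have c₅ : s₅.ivar 6 = s.ivar 6 + 1 := (F₅.ivar 6 rfl).trans ((F₄.ivar 6 rfl).trans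
    ((F₃.ivar 6 rfl).trans ((F₂.ivar 6 rfl).trans h6)))
  have j₅ : s₅.ivar 5 = s₄.ivar 5 := F₅.ivar 5 rfl
  have hcard := card_filter_update h.tree.head_le h.tree.head_rank hrank
  have hc := h.count
  refine ⟨⟨?_, ?_, ?_, ?_, ?_⟩, ?_⟩
  · simp [Cmd.result, n₅]
  · simp [Cmd.result, p₅, h.root]
  · simpa [Cmd.result, p₅, W₅] using hM
  · simpa [Cmd.result, IExpr.eval, p₅, W₅, r₅, w₅, c₅, j₅] using hT
  · simp only [Cmd.result, IExpr.eval, State.setI_iarr, State.setI_ivar, r₅, c₅]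
    simp only [Nat.reduceEqDiff, if_false]
    omega
  · simp [Cmd.result, c₅]
    omega

/-- Change the matching along the path from the free column `j₀` to the root. -/
def augment : Cmd :=
  .loop (.not (.ile (.var 0) (.var 4)))
    (.seq (.iput 0 (.const 0) (.var 4) (ivec 0 (ivec 1 (.var 4)))) (.iset 4 (ivec 1 (.var 4))))

theorem run_augment {n i : ℕ} {s₀ : State} (hn : s₀.ivar 0 = n)
    (h : IsAugmenting n i (s₀.rarr 2) (s₀.rarr 3 0) (s₀.rarr 4 0) (s₀.iarr 1 0) (s₀.iarr 2 0)
      (s₀.iarr 0 0) (s₀.ivar 4)) :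
    Run augment s₀ ((s₀.iarr 2 0 (s₀.ivar 4) + 1) * 40) fun s =>
      IsAugmenting n i (s₀.rarr 2) (s₀.rarr 3 0) (s₀.rarr 4 0) (s₀.iarr 1 0) (s₀.iarr 2 0)
        (s.iarr 0 0) n := by
  refine (Run.loop (K := 30) (fun s =>
      IsAugmenting n i (s₀.rarr 2) (s₀.rarr 3 0) (s₀.rarr 4 0) (s₀.iarr 1 0) (s₀.iarr 2 0)
        (s.iarr 0 0) (s.ivar 4)) (fun s => s₀.iarr 2 0 (s.ivar 4)) h ?_).mono ?_ ?_
  · intro s hF hI hb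
    have n₁ := (hF.ivar 0 rfl).trans hn
    have w₁ := hF.iarr 1 rfl
    simp only [BExpr.holds, IExpr.eval, n₁, not_le] at hb
    refine Run.of_result rfl (by decide) ?_
    have := hI.step (p' := fun j => if j = s.ivar 4 then s.iarr 0 0 (s₀.iarr 1 0 (s.ivar 4))
      else s.iarr 0 0 j) hb fun j => rfl
    have e : ((Cmd.seq (.iput 0 (.const 0) (.var 4) (ivec 0 (ivec 1 (.var 4))))
        (.iset 4 (ivec 1 (.var 4)))).result s).iarr 0 0 = fun j =>
        if j = s.ivar 4 then s.iarr 0 0 (s₀.iarr 1 0 (s.ivar 4)) else s.iarr 0 0 j := by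
      ext j
      simp [Cmd.result, IExpr.eval, w₁]
    have e' : ((Cmd.seq (.iput 0 (.const 0) (.var 4) (ivec 0 (ivec 1 (.var 4))))
        (.iset 4 (ivec 1 (.var 4)))).result s).ivar 4 = s₀.iarr 1 0 (s.ivar 4) := by
      simp [Cmd.result, IExpr.eval, w₁]
    rw [e, e']
    exact this
  · exact Nat.mul_le_mul_left _ (by decide)
  · rintro s hF ⟨hI, hb⟩
    have n₁ := (hF.ivar 0 rfl).trans hn
    simp only [BExpr.holds, IExpr.eval, n₁, not_not] at hb
    rwa [le_antisymm hI.head_le hb] at hI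

/-- Insert the row in the index variable `2` into the matching. -/
def insertRow : Cmd :=
  .seq clearTree
    (.seq (.seq (.iput 0 (.const 0) (.var 0) (.var 2)) (.seq (.iset 4 (.var 0)) (.iset 6 (.const 0))))
      (.seq (.loop (.not (.ile (.var 0) (ivec 0 (.var 4)))) growTree)
        (.seq (.iput 2 (.const 0) (.var 4) (.add (.var 6) (.const 1))) augment)))

theorem run_insertRow {n i : ℕ} (hi : i < n) {s : State} (hn : s.ivar 0 = n) (h2 : s.ivar 2 = i)
    (h : IsTightMatching n i (s.rarr 2) (s.rarr 3 0) (s.rarr 4 0) (s.iarr 0 0)) :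
    Run insertRow s ((n + 2) * (n + 2) * 700) fun s' =>
      IsTightMatching n (i + 1) (s'.rarr 2) (s'.rarr 3 0) (s'.rarr 4 0) (s'.iarr 0 0) := by
  have hrun := (run_clearTree hn).seq (Q := fun s' =>
      IsTightMatching n (i + 1) (s'.rarr 2) (s'.rarr 3 0) (s'.rarr 4 0) (s'.iarr 0 0))
    (K₂ := 20 + ((n + 1 + 1) * ((n + 2) * 400 + 20) + (10 + (n + 2) * 40))) (c₂ :=
    (.seq (.seq (.iput 0 (.const 0) (.var 0) (.var 2)) (.seq (.iset 4 (.var 0)) (.iset 6 (.const 0))))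
      (.seq (.loop (.not (.ile (.var 0) (ivec 0 (.var 4)))) growTree)
        (.seq (.iput 2 (.const 0) (.var 4) (.add (.var 6) (.const 1))) augment))))
    fun s₁ F₁ h₁ => ?_
  · exact hrun.mono (by nlinarith) fun _ _ h => h
  have n₁ := (F₁.ivar 0 rfl).trans hn
  have i₁ := (F₁.ivar 2 rfl).trans h2
  have p₁ := F₁.iarr 0 rfl
  refine Run.seq (Run.of_result (K := 20) (Q := fun s' => GrowInv n i s' ∧ s'.ivar 6 = 0) rfl
    (by decide) ?_) fun s₂ F₂ ⟨h₂, c₂⟩ => ?_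
  · simp only [Cmd.result, IExpr.eval, n₁, i₁]
    refine ⟨⟨by simp [n₁], by simp, ?_, ?_, ?_⟩, by simp⟩
    · have hp : ∀ j < n, ((((s₁.putI 0 0 n i).setI 4 ((s₁.putI 0 0 n i).ivar 0)).setI 6 0).iarr 0 0 j)
          = s.iarr 0 0 j := by
        intro j hj
        simp [hj.ne, p₁]
      have hW : (((s₁.putI 0 0 n i).setI 4 ((s₁.putI 0 0 n i).ivar 0)).setI 6 0).rarr 2 = s.rarr 2 :=
        F₁.rarr 2 rfl
      have ha : (((s₁.putI 0 0 n i).setI 4 ((s₁.putI 0 0 n i).ivar 0)).setI 6 0).rarr 3 = s.rarr 3 :=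
        F₁.rarr 3 rfl
      have hb : (((s₁.putI 0 0 n i).setI 4 ((s₁.putI 0 0 n i).ivar 0)).setI 6 0).rarr 4 = s.rarr 4 :=
        F₁.rarr 4 rfl
      rw [hW, ha, hb]
      exact h.congr hp
    · simp only [State.setI_ivar, State.putI_ivar, n₁, if_true]
      refine IsTree.init (fun j hj => ?_) (fun j hj => ?_)
      · simpa using (h₁ j hj).1
      · simpa using (h₁ j hj).2
    · have : ((Finset.range (n + 1)).filter fun j => s₁.iarr 2 0 j = 0) = Finset.range (n + 1) := by
        refine Finset.filter_true_of_mem fun j hj => (h₁ j ?_).1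
        simpa [Nat.lt_succ_iff] using hj
      simp [this]
  refine Run.seq (K₁ := (n + 1 + 1) * ((n + 2) * 400 + 20))
    (P := fun s' => GrowInv n i s' ∧ ¬ s'.iarr 0 0 (s'.ivar 4) < n) ?_ fun s₃ F₃ ⟨h₃, hj₃⟩ => ?_
  · refine (Run.loop (GrowInv n i) (fun s => n + 1 - s.ivar 6) h₂
      fun s hF hI hb => run_growTree hi hI ?_).mono ?_ ?_
    · simp only [BExpr.holds, IExpr.eval, hI.size, not_le] at hb
      exact hb
    · rw [c₂]
      simp only [BExpr.cost, IExpr.cost, Nat.sub_zero]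
      exact Nat.mul_le_mul_left _ (by omega)
    · rintro s' - ⟨hI, hb⟩
      simp only [BExpr.holds, IExpr.eval, hI.size, not_not] at hb
      exact ⟨hI, not_lt.2 hb⟩
  refine Run.seq (Run.of_result (K := 10) (Q := fun s' => ∀ j, s'.iarr 2 0 j =
    if j = s₃.ivar 4 then s₃.ivar 6 + 1 else s₃.iarr 2 0 j) rfl
    (by decide) (by simp [Cmd.result, IExpr.eval])) fun s₄ F₄ h₄ => ?_
  have haug := h₃.tree.isAugmenting h₃.matching hi h₃.root hj₃ h₄
  have n₄ := (F₄.ivar 0 rfl).trans h₃.size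
  have j₄ : s₄.ivar 4 = s₃.ivar 4 := F₄.ivar 4 rfl
  have hr₄ : s₄.iarr 2 0 (s₄.ivar 4) ≤ n + 1 := by
    rw [j₄, h₄, if_pos rfl]
    have := h₃.count_le
    omega
  rw [← j₄, ← F₄.rarr 2 rfl, ← F₄.rarr 3 rfl, ← F₄.rarr 4 rfl, ← F₄.iarr 1 rfl,
    ← F₄.iarr 0 rfl] at haug
  refine (run_augment n₄ haug).mono (Nat.mul_le_mul_right _ (by omega)) fun s₅ F₅ h₅ => ?_
  rw [F₅.rarr 2 rfl, F₅.rarr 3 rfl, F₅.rarr 4 rfl]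
  refine h₅.isTightMatching ?_
  rw [F₄.rarr 2 rfl, F₄.rarr 3 rfl, F₄.rarr 4 rfl]
  exact h₃.matching.feas

/-- The Hungarian method. -/
def hungarian : Cmd := forLoop 2 (.var 0) insertRow

theorem run_hungarian {n : ℕ} {s : State} (hn : s.ivar 0 = n)
    (h : IsTightMatching n 0 (s.rarr 2) (s.rarr 3 0) (s.rarr 4 0) (s.iarr 0 0)) :
    Run hungarian s ((n + 1) * ((n + 2) * (n + 2) * 700 + 20)) fun s' =>
      IsTightMatching n n (s'.rarr 2) (s'.rarr 3 0) (s'.rarr 4 0) (s'.iarr 0 0) := by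
  refine (Run.forLoop (K := (n + 2) * (n + 2) * 700) (m := n) (fun i s =>
    IsTightMatching n i (s.rarr 2) (s.rarr 3 0) (s.rarr 4 0) (s.iarr 0 0)) rfl ?_ h ?_).mono
    ?_ fun _ _ h => h
  · intro s' hF
    simp [IExpr.eval, hF.ivar 0 rfl, hn]
  · intro i hi s' hF h2 hI
    exact run_insertRow hi ((hF.ivar 0 rfl).trans hn) h2 hI
  · exact Nat.mul_le_mul_left _ (by simp only [IExpr.cost]; omega)

/-! ### A program for one iteration -/

/-- Compute the utility of the agent in the index variable `2`. -/
def rowUtility : Cmd :=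
  .seq (.rset 1 (.ofNat (.const 0)))
    (forLoop 3 (.var 0) (.rset 1 (.add (.var 1)
      (.mul (.get 0 (.var 2) (.var 3)) (.get 1 (.var 2) (.var 3))))))

theorem run_rowUtility {n : ℕ} {s₀ : State} (hn : s₀.ivar 0 = n) :
    Run rowUtility s₀ ((n + 1) * 50) fun s =>
      s.rvar 1 = ∑ j ∈ Finset.range n, s₀.rarr 0 (s₀.ivar 2) j * s₀.rarr 1 (s₀.ivar 2) j := by
  refine ((Run.of_result (K := 5) (Q := fun s => s.rvar 1 = 0) rfl (by decide)
    (by simp [Cmd.result, RExpr.eval, IExpr.eval])).seq (K₂ := (n + 1) * 40) (Q := fun s =>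
      s.rvar 1 = ∑ j ∈ Finset.range n, s₀.rarr 0 (s₀.ivar 2) j * s₀.rarr 1 (s₀.ivar 2) j)
      fun s₁ F₁ h₁ => ?_).mono (by omega) fun _ _ h => h
  refine (Run.forLoop (K := 20) (m := n) (fun m s => s.rvar 1 =
    ∑ j ∈ Finset.range m, s₀.rarr 0 (s₀.ivar 2) j * s₀.rarr 1 (s₀.ivar 2) j) rfl ?_ ?_ ?_).mono
    (Nat.mul_le_mul_left _ (by decide)) fun _ _ h => h
  · intro s hF
    simp [IExpr.eval, hF.ivar 0 rfl, F₁.ivar 0 rfl, hn]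
  · simp [h₁]
  · intro m hm s hF hj hI
    refine Run.of_result rfl (by decide) ?_
    rw [Finset.sum_range_succ, ← hI]
    simp [Cmd.result, RExpr.eval, IExpr.eval, hj, hF.ivar 2 rfl, F₁.ivar 2 rfl, hF.rarr 0 rfl,
      F₁.rarr 0 rfl, hF.rarr 1 rfl, F₁.rarr 1 rfl]

/-- Compute the derivative of the utility term of the agent in the index variable `2`, and
initialize the duals and the matching there. -/
def rowInit : Cmd :=
  .seq (.ite (.rle (.var 1) (.var 3))
      (.rset 2 (.sub (.div (.ofNat (.const 2)) (.var 3)) (.div (.var 1) (.mul (.var 3) (.var 3)))))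
      (.rset 2 (.div (.ofNat (.const 1)) (.var 1))))
    (.seq (.rput 3 (.const 0) (.var 2) (.var 2))
      (.seq (.rput 4 (.const 0) (.var 2) (.ofNat (.const 0)))
        (.iput 0 (.const 0) (.var 2) (.var 0))))

theorem run_rowInit (s₀ : State) :
    Run rowInit s₀ 60 fun s => s.rvar 2 = etaDeriv (s₀.rvar 1) (s₀.rvar 3) ∧
      (∀ j, s.rarr 3 0 j = if j = s₀.ivar 2 then etaDeriv (s₀.rvar 1) (s₀.rvar 3)
        else s₀.rarr 3 0 j) ∧
      (∀ j, s.rarr 4 0 j = if j = s₀.ivar 2 then 0 else s₀.rarr 4 0 j) ∧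
      (∀ j, s.iarr 0 0 j = if j = s₀.ivar 2 then s₀.ivar 0 else s₀.iarr 0 0 j) := by
  refine Run.of_result rfl (by decide) ?_
  simp only [rowInit, Cmd.result, BExpr.holds, RExpr.eval, IExpr.eval, etaDeriv]
  by_cases h : s₀.rvar 1 ≤ s₀.rvar 3 <;> simp [h, sq]

/-- Compute the weights in the row in the index variable `2`. -/
def rowWeights : Cmd :=
  forLoop 3 (.var 0) (.rput 2 (.var 2) (.var 3) (.mul (.var 2) (.get 0 (.var 2) (.var 3))))

theorem run_rowWeights {n : ℕ} {s₀ : State} (hn : s₀.ivar 0 = n) :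
    Run rowWeights s₀ ((n + 1) * 50) fun s => ∀ i, ∀ j < n, s.rarr 2 i j =
      if i = s₀.ivar 2 then s₀.rvar 2 * s₀.rarr 0 i j else s₀.rarr 2 i j := by
  refine (Run.forLoop (K := 20) (m := n) (fun m s => ∀ i j, s.rarr 2 i j =
      if i = s₀.ivar 2 ∧ j < m then s₀.rvar 2 * s₀.rarr 0 i j else s₀.rarr 2 i j) rfl ?_ ?_ ?_).mono
    (Nat.mul_le_mul_left _ (by decide)) fun s _ h i j hj => ?_
  · intro s hF
    simp [IExpr.eval, hF.ivar 0 rfl, hn]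
  · simp
  · intro m hm s hF hj hI
    refine Run.of_result rfl (by decide) ?_
    intro i j
    simp only [Cmd.result, RExpr.eval, IExpr.eval, hj, hF.ivar 2 rfl, hF.rvar 2 rfl,
      hF.rarr 0 rfl, State.setI_rarr, State.putR_rarr, hI]
    grind
  · rw [h]
    simp [hj]

/-- Compute the weights and initialize the Hungarian method. -/
def computeWeights : Cmd :=
  .seq (.rset 3 (.div (.ofNat (.const 1))
      (.mul (.mul (.ofNat (.const 2)) (.var 0)) (.ofNat (.var 0)))))
    (forLoop 2 (.var 0) (.seq rowUtility (.seq rowInit rowWeights)))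

theorem run_computeWeights {n : ℕ} {s₀ : State} (hn : s₀.ivar 0 = n) {G : ℕ → ℝ}
    (hG : ∀ i, G i = etaDeriv (∑ j ∈ Finset.range n, s₀.rarr 0 i j * s₀.rarr 1 i j)
      (1 / (2 * s₀.rvar 0 * (n : ℝ)))) :
    Run computeWeights s₀ ((n + 1) * ((n + 1) * 250)) fun s => ∀ i < n,
      s.rarr 3 0 i = G i ∧ s.rarr 4 0 i = 0 ∧ s.iarr 0 0 i = n ∧
        ∀ j < n, s.rarr 2 i j = G i * s₀.rarr 0 i j := by
  refine ((Run.of_result (K := 15) (Q := fun s => s.rvar 3 = 1 / (2 * s₀.rvar 0 * (n : ℝ))) rfl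
    (by decide) (by simp [Cmd.result, RExpr.eval, IExpr.eval, hn])).seq
      (K₂ := (n + 1) * (((n + 1) * 50 + (60 + (n + 1) * 50)) + 20)) (Q := fun s => ∀ i < n,
      s.rarr 3 0 i = G i ∧ s.rarr 4 0 i = 0 ∧ s.iarr 0 0 i = n ∧
        ∀ j < n, s.rarr 2 i j = G i * s₀.rarr 0 i j)
      fun s₁ F₁ h₁ => ?_).mono (by nlinarith) fun _ _ h => h
  refine (Run.forLoop (K := (n + 1) * 50 + (60 + (n + 1) * 50)) (m := n) (fun m s => ∀ i < m,
      s.rarr 3 0 i = G i ∧ s.rarr 4 0 i = 0 ∧ s.iarr 0 0 i = n ∧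
        ∀ j < n, s.rarr 2 i j = G i * s₀.rarr 0 i j) rfl ?_ ?_ ?_).mono
    (Nat.mul_le_mul_left _ (by simp only [IExpr.cost]; omega)) fun _ _ h => h
  · intro s hF
    simp [IExpr.eval, hF.ivar 0 rfl, F₁.ivar 0 rfl, hn]
  · simp
  · intro m hm s₂ F₂ hi₂ hI
    have n₂ : s₂.ivar 0 = n := (F₂.ivar 0 rfl).trans ((F₁.ivar 0 rfl).trans hn)
    have u₂ : s₂.rarr 0 = s₀.rarr 0 := (F₂.rarr 0 rfl).trans (F₁.rarr 0 rfl)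
    have x₂ : s₂.rarr 1 = s₀.rarr 1 := (F₂.rarr 1 rfl).trans (F₁.rarr 1 rfl)
    have z₂ : s₂.rvar 3 = 1 / (2 * s₀.rvar 0 * (n : ℝ)) := (F₂.rvar 3 rfl).trans h₁
    refine (run_rowUtility n₂).seq fun s₃ F₃ h₃ => ?_
    rw [hi₂, u₂, x₂] at h₃
    refine (run_rowInit s₃).seq fun s₄ F₄ ⟨hg, ha, hb, hp⟩ => ?_
    have i₃ : s₃.ivar 2 = m := (F₃.ivar 2 rfl).trans hi₂
    have n₃ : s₃.ivar 0 = n := (F₃.ivar 0 rfl).trans n₂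
    have e : etaDeriv (s₃.rvar 1) (s₃.rvar 3) = G m := by
      rw [h₃, F₃.rvar 3 rfl, z₂, hG]
    rw [e] at hg ha
    rw [i₃] at ha hb hp
    rw [n₃] at hp
    have n₄ : s₄.ivar 0 = n := (F₄.ivar 0 rfl).trans n₃
    have i₄ : s₄.ivar 2 = m := (F₄.ivar 2 rfl).trans i₃
    have u₄ : s₄.rarr 0 = s₀.rarr 0 := (F₄.rarr 0 rfl).trans ((F₃.rarr 0 rfl).trans u₂)
    refine (run_rowWeights n₄).mono le_rfl fun s₅ F₅ h₅ => ?_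
    rw [i₄, hg, u₄] at h₅
    intro i hi
    simp only [State.setI_rarr, State.setI_iarr]
    rw [F₅.rarr 3 rfl, F₅.rarr 4 rfl, F₅.iarr 0 rfl, ha, hb, hp]
    by_cases him : i = m
    · subst him
      simp only [if_true, true_and]
      intro j hj
      rw [h₅ i j hj, if_pos rfl]
    · simp only [if_neg him]
      obtain ⟨g1, g2, g3, g4⟩ := hI i (by omega)
      rw [F₃.rarr 3 rfl, F₃.rarr 4 rfl, F₃.iarr 0 rfl]
      refine ⟨g1, g2, g3, fun j hj => ?_⟩
      rw [h₅ i j hj, if_neg him, F₄.rarr 2 rfl, F₃.rarr 2 rfl]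
      exact g4 j hj

/-- Change one entry of the iterate. -/
def updateEntry : Cmd :=
  .ite (.and (.ile (ivec 0 (.var 3)) (.var 2)) (.ile (.var 2) (ivec 0 (.var 3))))
    (.rput 1 (.var 2) (.var 3) (.add (.mul (.var 1) (.get 1 (.var 2) (.var 3))) (.var 2)))
    (.rput 1 (.var 2) (.var 3) (.mul (.var 1) (.get 1 (.var 2) (.var 3))))

theorem run_updateEntry {s₀ : State} :
    Run updateEntry s₀ 40 fun s => ∀ i j, s.rarr 1 i j =
      if i = s₀.ivar 2 ∧ j = s₀.ivar 3 then s₀.rvar 1 * s₀.rarr 1 i j +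
        (if s₀.iarr 0 0 j = i then s₀.rvar 2 else 0) else s₀.rarr 1 i j := by
  refine Run.of_result rfl (by decide) fun i j => ?_
  simp only [updateEntry, Cmd.result, BExpr.holds, RExpr.eval, IExpr.eval, ← le_antisymm_iff]
  split_ifs <;> simp only [State.putR_rarr] <;> grind

/-- Move the iterate towards the matching. -/
def updateIterate : Cmd :=
  .seq (.seq (.rset 2 (.div (.ofNat (.const 2)) (.add (.ofNat (.var 1)) (.ofNat (.const 1)))))
      (.rset 1 (.sub (.ofNat (.const 1)) (.var 2))))
    (.seq (forLoop 2 (.var 0) (forLoop 3 (.var 0) updateEntry))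
      (.iset 1 (.add (.var 1) (.const 1))))

theorem run_updateIterate {n t : ℕ} {s₀ : State} (hn : s₀.ivar 0 = n) (ht : s₀.ivar 1 = t) :
    Run updateIterate s₀ ((n + 1) * ((n + 1) * 120)) fun s => s.ivar 1 = t + 1 ∧
      ∀ i < n, ∀ j < n, s.rarr 1 i j = (1 - 2 / ((t : ℝ) + 1)) * s₀.rarr 1 i j +
        if s₀.iarr 0 0 j = i then 2 / ((t : ℝ) + 1) else 0 := by
  set c := 2 / ((t : ℝ) + 1) with hc
  set F : ℕ → ℕ → ℝ := fun i j => (1 - c) * s₀.rarr 1 i j + if s₀.iarr 0 0 j = i then c else 0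
    with hF
  refine ((Run.of_result (K := 15) (Q := fun s => s.rvar 2 = c ∧ s.rvar 1 = 1 - c) rfl
    (by decide) (by simp [Cmd.result, RExpr.eval, IExpr.eval, ht, hc])).seq
      (K₂ := (n + 1) * ((n + 1) * 60 + 20) + 5) (Q := fun s => s.ivar 1 = t + 1 ∧
      ∀ i < n, ∀ j < n, s.rarr 1 i j = F i j)
      fun s₁ F₁ ⟨c₁, d₁⟩ => ?_).mono (by nlinarith) fun _ _ h => h
  have n₁ := (F₁.ivar 0 rfl).trans hn
  have t₁ := (F₁.ivar 1 rfl).trans ht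
  have p₁ := F₁.iarr 0 rfl
  have x₁ := F₁.rarr 1 rfl
  refine Run.seq (P := fun s => ∀ i j, j < n → s.rarr 1 i j = if i < n then F i j
    else s₀.rarr 1 i j) ?_ fun s₂ F₂ h₂ => ?_
  · refine (Run.forLoop (K := (n + 1) * 60) (m := n) (fun m s => ∀ i j, j < n → s.rarr 1 i j =
      if i < m then F i j else s₀.rarr 1 i j) rfl ?_ ?_ ?_).mono
      (Nat.mul_le_mul_left _ (by simp only [IExpr.cost]; omega)) fun _ _ h => h
    · intro s hF
      simp [IExpr.eval, hF.ivar 0 rfl, n₁]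
    · simp [x₁]
    · intro m hm s₂ F₂ i₂ hI
      have n₂ := (F₂.ivar 0 rfl).trans n₁
      refine (Run.forLoop (K := 40) (m := n) (fun k s => ∀ i j, j < n → s.rarr 1 i j =
        if i < m ∨ i = m ∧ j < k then F i j else s₀.rarr 1 i j) rfl ?_ ?_ ?_).mono
        (Nat.mul_le_mul_left _ (by decide)) fun s F₃ h i j hj => ?_
      · intro s hF
        simp [IExpr.eval, hF.ivar 0 rfl, n₂]
      · simpa using hI
      · intro k hk s₃ F₃ j₃ hI₃
        have i₃ := (F₃.ivar 2 rfl).trans i₂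
        have c₃ := (F₃.rvar 2 rfl).trans ((F₂.rvar 2 rfl).trans c₁)
        have d₃ := (F₃.rvar 1 rfl).trans ((F₂.rvar 1 rfl).trans d₁)
        have p₃ := (F₃.iarr 0 rfl).trans ((F₂.iarr 0 rfl).trans p₁)
        refine run_updateEntry.mono le_rfl fun s₄ F₄ h₄ i j hj => ?_
        rw [State.setI_rarr, h₄, i₃, j₃, c₃, d₃, p₃, hI₃ i j hj]
        simp only [hF]
        grind
      · rw [State.setI_rarr, h i j hj]
        grind
  · refine Run.of_result rfl (by decide) ⟨?_, fun i hi j hj => ?_⟩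
    · simp [Cmd.result, IExpr.eval, F₂.ivar 1 rfl, t₁]
    · simp [Cmd.result, h₂ i j hj, hi]

/-- One iteration of the conditional gradient algorithm. -/
def iteration : Cmd := .seq computeWeights (.seq hungarian updateIterate)

theorem run_iteration {n : ℕ} {κ : ℝ} {u : Fin n → Fin n → ℝ} (hn : 0 < n) (h : IsInstance κ u)
    {t : ℕ} {x : Alloc n} {s : State} (hs : Stores s t κ u x) :
    Run iteration s (30000 * n ^ 3) fun s' =>
      ∃ x' : Alloc n, IsStep κ u t x x' ∧ Stores s' (t + 1) κ u x' := by
  obtain ⟨hs0, hs1, hsκ, hsu, hsx⟩ := hs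
  have hκ := h.kappa_pos
  obtain ⟨G, hG⟩ : ∃ G : ℕ → ℝ, ∀ i, G i = etaDeriv (∑ j ∈ Finset.range n,
    s.rarr 0 i j * s.rarr 1 i j) (1 / (2 * s.rvar 0 * (n : ℝ))) := ⟨_, fun _ => rfl⟩
  have hgrad : ∀ i j : Fin n, gradPsi κ u x i j = G i * u i j := by
    intro i j
    rw [gradPsi_eq hκ hn, hG, hsκ, Finset.sum_range]
    simp only [hsu, hsx]
    rfl
  have hG0 : ∀ i, 0 ≤ G i := by
    intro i
    rw [hG, hsκ]
    exact etaDeriv_nonneg (threshold_pos hκ hn) _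
  refine ((run_computeWeights hs0 hG).seq
    (K₂ := (n + 1) * ((n + 2) * (n + 2) * 700 + 20) + (n + 1) * ((n + 1) * 120))
    (Q := fun s' => ∃ x' : Alloc n, IsStep κ u t x x' ∧ Stores s' (t + 1) κ u x')
    fun s₁ F₁ h₁ => ?_).mono ?_ fun _ _ h => h
  swap
  · obtain ⟨m, rfl⟩ : ∃ m, n = m + 1 := ⟨n - 1, by omega⟩
    calc _ = 700 * m ^ 3 + 5970 * m ^ 2 + 16200 * m + 14120 := by ring
      _ ≤ 30000 * (m + 1) ^ 3 := by ring_nf; omega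
  have n₁ := (F₁.ivar 0 rfl).trans hs0
  have hM : IsTightMatching n 0 (s₁.rarr 2) (s₁.rarr 3 0) (s₁.rarr 4 0) (s₁.iarr 0 0) := by
    refine ⟨fun r hr j hj => ?_, fun j hj hp => ?_, fun j hj j' hj' hp => ?_, fun j hj => ?_,
      fun r hr => by omega⟩
    · obtain ⟨ha, -, -, hW⟩ := h₁ r hr
      rw [ha, (h₁ j hj).2.1, hW j hj, hsu ⟨r, hr⟩ ⟨j, hj⟩, add_zero]
      exact mul_le_of_le_one_right (hG0 r) (h.le_one _ _)
    · have := (h₁ j hj).2.2.1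
      omega
    · have := (h₁ j hj).2.2.1
      omega
    · exact Or.inr (h₁ j hj).2.2.1
  refine (run_hungarian n₁ hM).seq fun s₂ F₂ h₂ => ?_
  have n₂ := (F₂.ivar 0 rfl).trans n₁
  have t₂ := (F₂.ivar 1 rfl).trans ((F₁.ivar 1 rfl).trans hs1)
  obtain ⟨σ, hσ, htight⟩ := h₂.exists_perm
  have hW : ∀ i j : Fin n, s₂.rarr 2 i j = gradPsi κ u x i j := by
    intro i j
    rw [F₂.rarr 2 rfl, (h₁ i i.2).2.2.2 j j.2, hsu, hgrad]
  have hmax : IsMaxWeightMatching (gradPsi κ u x) (permAlloc σ) := by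
    refine isMaxWeightMatching_of_dual (gradPsi_nonneg h hn x) (fun i => s₂.rarr 3 0 i)
      (fun j => s₂.rarr 4 0 j) (fun i j => ?_) σ fun i => ?_
    · rw [← hW]
      exact h₂.feas i i.2 j j.2
    · rw [← hW]
      exact htight i
  refine (run_updateIterate n₂ t₂).mono le_rfl fun s₃ F₃ ⟨t₃, h₃⟩ => ?_
  refine ⟨_, ⟨_, hmax, rfl⟩, (F₃.ivar 0 rfl).trans n₂, t₃, (F₃.rvar 0 rfl).trans
    ((F₂.rvar 0 rfl).trans ((F₁.rvar 0 rfl).trans hsκ)), fun i j => ?_, fun i j => ?_⟩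
  · rw [F₃.rarr 0 rfl, F₂.rarr 0 rfl, F₁.rarr 0 rfl, hsu]
  · rw [h₃ i i.2 j j.2, F₂.rarr 1 rfl, F₁.rarr 1 rfl, hsx]
    simp [permAlloc, hσ]

end LiF

theorem mainTheorem2 :
    (∃ C : ℝ, 0 < C ∧ ∀ (n : ℕ) (κ : ℝ) (u : Fin n → Fin n → ℝ), 0 < n → LiF.IsInstance κ u →
      (∃ xstar : LiF.Alloc n, LiF.IsOptimal κ u xstar) ∧
      ∀ xstar : LiF.Alloc n, LiF.IsOptimal κ u xstar →
        ∀ ε : ℝ, 0 < ε → ∀ T : ℕ, C * ((n : ℝ) ^ 3 * κ ^ 2 / ε) ≤ (T : ℝ) →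
          ∀ x : ℕ → LiF.Alloc n, LiF.IsRun κ u T x →
            x T ∈ LiF.matchingPolytope n ∧ LiF.psi κ u xstar - LiF.psi κ u (x T) ≤ ε) ∧
    (∃ (iteration : RealRAM.Cmd) (C : ℕ), ∀ (n : ℕ) (κ : ℝ) (u : Fin n → Fin n → ℝ), 0 < n →
      LiF.IsInstance κ u →
      ∀ (t : ℕ) (x : LiF.Alloc n), 1 ≤ t → x ∈ LiF.matchingPolytope n →
        ∀ s : RealRAM.State, LiF.Stores s t κ u x →
          ∃ (s' : RealRAM.State) (x' : LiF.Alloc n) (k : ℕ),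
            RealRAM.Exec iteration s s' k ∧ k ≤ C * n ^ 3 ∧
              LiF.IsStep κ u t x x' ∧ LiF.Stores s' (t + 1) κ u x') := by
  refine ⟨⟨8, by norm_num, fun n κ u hn h => ⟨LiF.exists_isOptimal h.kappa_pos hn u,
    fun xs hxs ε hε T hT x hrun => hrun.gap_le_eps h hn hxs.1 hε hT⟩⟩,
    LiF.iteration, 30000, fun n κ u hn h t x _ _ s hs => ?_⟩
  obtain ⟨s', k, he, hk, x', hstep, hst⟩ := LiF.run_iteration hn h hs
  exact ⟨s', x', k, he, hk, hstep, hst⟩
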